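/- **Limit transformers.** Let $\Sigma$ be a finite nonempty vocabulary. A single-layer, single-head limit transformer $f$ consists of token embeddings $E_s\in\mathbb R^d$ ($s\in\Sigma$), positional embeddings $p_i\in\mathbb R^d$, matrices $K,Q,V,A,B,U$, a bias $b$, a $1$-Lipschitz activation $\psi$, and a function $\phi(j,i)\in\mathbb R$ of pairs of positions. At $\mathsf p\ge 1$ bits of precision it maps a nonempty sequence $x=x_1\cdots x_n\in\Sigma^n$ to a vector $f(x)$ as follows. Put $y_i=E_{x_i}+p_i$, $a_j=y_j^\top K^\top Q\,y_n+\phi(j,n)$ and $w_j=\mathrm{rd}\big(\exp(\log n\cdot(a_j-\max_{j'\le n}a_{j'}))\big)$, where $\mathrm{rd}(t)=0$ if $|t|\le 2^{-\mathsf p}$ and $\mathrm{rd}(t)=t$ otherwise. Then $$Y=y_n+\frac{\sum_{j\le n} w_jVy_j}{\sum_{j\le n} w_j},\qquad f(x)=U\big(Y+B\,\psi(AY+b)\big).$$ $f$ is $\Delta$-periodic if $p_{i+\Delta}=p_i$ for all $i$, translation invariant if $\phi(j+t,i+t)=\phi(j,i)$ for all $t$, and $\tau$-local if $\phi(j,i)=0$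 whenever $i>j+\tau$. The logit margin $\gamma(f)\in(0,\infty]$ is the least positive difference $a-a'$ of two elements of a common set $$\mathcal A_{(y,i)}=\{(E_z+p_{i-r})^\top K^\top Q(E_y+p_i)+\phi(1,r+1): z\in\Sigma,\ r=0,1,2,\dots\}\qquad (y\in\Sigma,\ i\in\mathbb Z/\Delta),$$ and $\gamma(f)=\infty$ if there is no such difference. With Euclidean norms, operator norms, and $\|\psi\|$ the Lipschitz constant of $\psi$, put $$L_f=\max_{s\in\Sigma,\ i\in\mathbb Z/\Delta}\ \|U\|\,(1+\|A\|\|B\|\|\psi\|)\,\big(\|V(E_s+p_i)\|+\|E_s+p_i\|+\|b\|\big).$$ **Average error.** Let $\alpha_s>0$ for $s\in\Sigma$, $\alpha_0=\min_s\alpha_s$ and $\alpha^*=\sum_s\alpha_s$. For two limit transformers $f,g$ with the same output dimension and $n\ge1$, put $$\|f-g\|_{n,\mathcal P}=\sum_{x\in\Sigma^n}\Big(\prod_{i=1}^n p_{x_i}\Big)\|f(x)-g(x)\|,\qquad \|f-g\|_n=\mathbb E_{\mathcal P\sim\mathrm{Dir}((\alpha_s)_{s\in\Sigma})}\big[\|f-g\|_{n,\mathcal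 P}\big],$$ where $\mathcal P=(p_s)_{s\in\Sigma}$ is a probability distribution on $\Sigma$. **Theorem.** There are an absolute constant $C>0$ and, for every $\tau\ge0$, an $\varepsilon_0>0$ depending only on $\tau$ such that the following holds for all $\Sigma$, $(\alpha_s)$, $\mathsf p\ge1$, $\Delta\ge1$ and all single-layer, single-head limit transformers $f,g$ (of arbitrary inner dimensions and with the same output dimension) which are $\Delta$-periodic, translation invariant and $\tau$-local and operate at $\mathsf p$ bits of precision. Let $\gamma=\min\{\gamma(f),\gamma(g)\}$ and $L=L_f+L_g$. For every $0<\varepsilon\le\varepsilon_0$ there is an integer $N_0=N_0(\varepsilon)\ge 0$ with $$N_0\le C\max\left\{2^{\mathsf p/\gamma},\ \frac{16^{\alpha^*/\alpha_0}\,L^{2+2/\alpha_0}\,|\Sigma|^{4+2/\alpha_0}\,\Delta^5}{\alpha_0^{2/\alpha_0}\,\varepsilon^{2+2/\alpha_0}}\,\log\frac{|\Sigma|\Delta L}{\varepsilon}\right\}$$ (the second term being read as $0$ if $L=0$) such that, if $\|f-g\|_N\le\varepsilon$ for all $1\le N\le N_0$, then $\|f-g\|_T\le C\varepsilon^{1/2}$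 for every $T\ge1$. In particular, for fixed $f,g,\alpha$ one has $N_0(\varepsilon)=O\big(\varepsilon^{-2-2/\alpha_0}\log(1/\varepsilon)\big)=\widetilde O(\varepsilon^{-2-2/\alpha_0})$ as $\varepsilon\to0^+$. -/

import Mathlib

open scoped ENNReal NNReal

universe u

noncomputable section

/-- `n`-dimensional Euclidean space, with the Euclidean norm. -/
abbrev Vec (n : ℕ) : Type := EuclideanSpace ℝ (Fin n)

/-- The Lipschitz constant `‖ψ‖` of a map between Euclidean spaces (its least Lipschitz constant). -/
def lipConst {m n : ℕ} (ψ : Vec m → Vec n) : ℝ≥0 := sInf {K : ℝ≥0 | LipschitzWith K ψ}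

/-- The rounding of `p` bits of precision: quantities of absolute value at most `2 ^ (-p)` become
`0`. -/
def roundOff (p : ℕ) (t : ℝ) : ℝ := if |t| ≤ ((2 : ℝ) ^ p)⁻¹ then 0 else t

/-- The parameters of a single-layer, single-head limit transformer over the vocabulary `Tok`, with
embedding dimension `d`, key/query dimension `k`, hidden width `m` and output dimension `o`.
Matrices are linear maps between Euclidean spaces, so that `‖·‖` is their operator norm.
Positions are integers; only the positions `1, …, |x|` of an input `x` are ever used. -/
structure LimitTransformer (Tok : Type u) (d k m o : ℕ) where
  /-- token embeddings -/
  E : Tok → Vec d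
  /-- positional embeddings -/
  pos : ℤ → Vec d
  /-- key matrix -/
  K : Vec d →L[ℝ] Vec k
  /-- query matrix -/
  Q : Vec d →L[ℝ] Vec k
  /-- value matrix -/
  V : Vec d →L[ℝ] Vec d
  /-- positional modification `φ (j, i)` of the logit of key position `j` and query position `i` -/
  φ : ℤ → ℤ → ℝ
  /-- hidden layer weights -/
  A : Vec d →L[ℝ] Vec m
  /-- hidden layer bias -/
  b : Vec m
  /-- output layer weights -/
  B : Vec m →L[ℝ] Vec d
  /-- activation function -/
  ψ : Vec m → Vec m
  /-- the activation is `1`-Lipschitz -/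
  lipschitz_ψ : LipschitzWith 1 ψ
  /-- unembedding matrix -/
  U : Vec d →L[ℝ] Vec o

namespace LimitTransformer

variable {Tok : Type u} {d k m o : ℕ}

/-- `Δ`-periodicity of the positional embeddings. -/
def IsPeriodic (f : LimitTransformer Tok d k m o) (Δ : ℕ) : Prop :=
  ∀ i : ℤ, f.pos (i + Δ) = f.pos i

/-- Translation invariance of `φ`. -/
def IsTranslationInvariant (f : LimitTransformer Tok d k m o) : Prop :=
  ∀ j i t : ℤ, f.φ (j + t) (i + t) = f.φ j i

/-- `τ`-locality of `φ`. -/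
def IsLocal (f : LimitTransformer Tok d k m o) (τ : ℕ) : Prop :=
  ∀ j i : ℤ, j + τ < i → f.φ j i = 0

/-- The embedding `E_s + p_i` of the token `s` at position `i`. -/
def embed (f : LimitTransformer Tok d k m o) (s : Tok) (i : ℤ) : Vec d := f.E s + f.pos i

/-- `A_{(y,i),(z,j)} = (E_z + p_j)ᵀ Kᵀ Q (E_y + p_i)`: the position-free part of the logit of the
query token `y` at position `i` and the key token `z` at position `j`. -/
def attn (f : LimitTransformer Tok d k m o) (y : Tok) (i : ℤ) (z : Tok) (j : ℤ) : ℝ :=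
  inner ℝ (f.K (f.embed z j)) (f.Q (f.embed y i))

/-- All attention logits that can be observed while processing the token `y` at a position congruent
to `i` modulo the period: the key token is `z` and lies `r` positions back. -/
def logitSet (f : LimitTransformer Tok d k m o) (y : Tok) (i : ℤ) : Set ℝ :=
  {a | ∃ (z : Tok) (r : ℕ), a = f.attn y i z (i - r) + f.φ 1 (r + 1)}

/-- The logit margin `γ(f)`: the least positive difference of two logits in a common logit set
(`∞` if there is none). -/
def logitMargin (f : LimitTransformer Tok d k m o) : ℝ≥0∞ :=
  ⨅ (y : Tok) (i : ℤ) (a ∈ f.logitSet y i) (a' ∈ f.logitSet y i) (_ : a' < a),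
    ENNReal.ofReal (a - a')

/-- The norm quantity `L_f`. -/
def normBound (f : LimitTransformer Tok d k m o) (Δ : ℕ) : ℝ :=
  ⨆ q : Tok × Fin Δ,
    ‖f.U‖ * (1 + ‖f.A‖ * ‖f.B‖ * (lipConst f.ψ : ℝ)) *
      (‖f.V (f.embed q.1 (q.2 : ℕ))‖ + ‖f.embed q.1 (q.2 : ℕ)‖ + ‖f.b‖)

variable {n : ℕ}

/-- The input features `y_i = E_{x_i} + p_i`. The index `i : Fin n` stands for the position
`i + 1 ∈ {1, …, n}`. -/
def feature (f : LimitTransformer Tok d k m o) (x : Fin n → Tok) (i : Fin n) : Vec d :=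
  f.embed (x i) ((i : ℕ) + 1)

/-- The attention logit `a_{i,j}`. -/
def logit (f : LimitTransformer Tok d k m o) (x : Fin n → Tok) (i j : Fin n) : ℝ :=
  inner ℝ (f.K (f.feature x j)) (f.Q (f.feature x i)) + f.φ ((j : ℕ) + 1) ((i : ℕ) + 1)

/-- The largest logit `max_{j ≤ i} a_{i,j}`. -/
def maxLogit (f : LimitTransformer Tok d k m o) (x : Fin n → Tok) (i : Fin n) : ℝ :=
  (Finset.Iic i).sup' ⟨i, Finset.mem_Iic.2 le_rfl⟩ (f.logit x i)

/-- The unnormalized softmax weight at `p` bits of precision: the largest logit is shifted to `0`,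
and after exponentiation terms of size at most `2 ^ (-p)` are rounded to `0`. -/
def weight (f : LimitTransformer Tok d k m o) (p : ℕ) (x : Fin n → Tok) (i j : Fin n) : ℝ :=
  roundOff p (Real.exp (Real.log n * (f.logit x i j - f.maxLogit x i)))

/-- The pre-activation features `Y_i`: residual connection plus attention head. -/
def preAct (f : LimitTransformer Tok d k m o) (p : ℕ) (x : Fin n → Tok) (i : Fin n) : Vec d :=
  f.feature x i +
    (∑ j ∈ Finset.Iic i, f.weight p x i j)⁻¹ •
      ∑ j ∈ Finset.Iic i, f.weight p x i j • f.V (f.feature x j)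

/-- The output logits at position `i`: residual connection plus MLP, followed by unembedding. -/
def outputAt (f : LimitTransformer Tok d k m o) (p : ℕ) (x : Fin n → Tok) (i : Fin n) : Vec o :=
  f.U (f.preAct p x i + f.B (f.ψ (f.A (f.preAct p x i) + f.b)))

/-- The output `f(x)` of the transformer on a nonempty sequence `x`: the output logits at the last
position (`0` by convention for the empty sequence). -/
def output (f : LimitTransformer Tok d k m o) (p : ℕ) (x : Fin n → Tok) : Vec o :=
  if h : 0 < n then f.outputAt p x ⟨n - 1, Nat.sub_lt h Nat.one_pos⟩ else 0

end LimitTransformer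

/-- The Dirichlet distribution with parameters `α`, as a measure on `Tok → ℝ` carried by the
probability simplex: the law of `(G_s / ∑ t, G_t)_s` for independent `G_s ∼ Gamma(α_s, 1)`. -/
def dirichletMeasure {Tok : Type u} [Fintype Tok] (α : Tok → ℝ) :
    MeasureTheory.Measure (Tok → ℝ) :=
  (MeasureTheory.Measure.pi fun s => ProbabilityTheory.gammaMeasure (α s) 1).map
    fun G s => G s / ∑ t, G t

/-- `‖f - g‖_{n,P} = ∑_{|x| = n} P(x) ‖f(x) - g(x)‖`, for i.i.d. tokens with probabilities `P`. -/
def errorGiven {Tok : Type u} [Fintype Tok] {d k m d' k' m' o : ℕ}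
    (f : LimitTransformer Tok d k m o) (g : LimitTransformer Tok d' k' m' o)
    (p n : ℕ) (P : Tok → ℝ) : ℝ :=
  ∑ x : Fin n → Tok, (∏ i, P (x i)) * ‖f.output p x - g.output p x‖

/-- `‖f - g‖_n`, the expectation of `‖f - g‖_{n,P}` over `P ∼ Dir(α)`. -/
def avgError {Tok : Type u} [Fintype Tok] {d k m d' k' m' o : ℕ}
    (f : LimitTransformer Tok d k m o) (g : LimitTransformer Tok d' k' m' o)
    (α : Tok → ℝ) (p n : ℕ) : ℝ :=
  ∫ P, errorGiven f g p n P ∂(dirichletMeasure α)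

/-- The training length
`max {2^{p/γ}, 16^{α*/α₀} L^{2+2/α₀} S^{4+2/α₀} Δ^5 / (α₀^{2/α₀} ε^{2+2/α₀}) · log (S Δ L / ε)}`,
where `S` is the size of the vocabulary and `p / ∞ = 0`. -/
def lengthBound (p : ℕ) (γ : ℝ≥0∞) (S Δ : ℕ) (αsum αmin L ε : ℝ) : ℝ :=
  max ((2 : ℝ) ^ ((p : ℝ≥0∞) / γ).toReal)
    ((16 : ℝ) ^ (αsum / αmin) * L ^ (2 + 2 / αmin) * (S : ℝ) ^ (4 + 2 / αmin) * (Δ : ℝ) ^ 5 /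
        (αmin ^ (2 / αmin) * ε ^ (2 + 2 / αmin)) *
      Real.log (S * Δ * L / ε))

end

/-! Read an input as a prefix of length aΔ followed by a suffix s of length l + 1 with τ ≤ l < τ +
Δ. From length 2^(p/γ) on, rounding turns the attention of the last position into a uniform average
over the positions of maximal logit, because every other logit is at least γ lower
(`weight_eq_ite`). By locality and periodicity the logit of a prefix position depends only on its
token, its residue mod Δ and s; by periodicity and translation invariance the suffix logits do not
depend on a. So there are two cases. If the suffix beats every possible prefix logit, the output is
a function of s alone. Otherwise, as soon as some prefix position attains the top prefix logit, the
head averages the values over all such positions and at most l + 1 suffix positions. For i.i.d.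
tokens of probability at least q each, the expected number of such hits is at least aq, and second
moments show that the output is on average close to a limit F(s) that does not depend on a
(`exists_limit_output`).

Let G(s) be the limit for g. The errors at the lengths aΔ + l + 1 and bΔ + l + 1 are then both close
to the mean of ‖F(s) - G(s)‖ over the same law of s, which transfers a small error from a short
length to a long one (`errorGiven_le_add_of_le_coord`).

Averaging over the Dirichlet law costs the event that some token has probability below q. An
exponential Markov bound for Gamma variables controls its probability
(`dirichletMeasure_exists_lt_le`); on it, the errors at two lengths still differ by at most 4L,
since the outputs of one transformer oscillate by at most 4 L_f. The number q is chosen to make this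
contribution 4ε, and the training length then makes aq so large that the concentration error is
O(ε). If L ≥ √ε the resulting bound is linear in ε; the exponent 1/2 is needed only for L < √ε,
where oscillation alone suffices. -/

/-! ### Second moments of sums over i.i.d. sequences -/

section Sequences

variable {Tok : Type u} [Fintype Tok]

theorem sum_cons_sequences {H : Type*} [AddCommGroup H] [Module ℝ H] (P : Tok → ℝ) {n : ℕ}
    (h : (Fin (n + 1) → Tok) → H) :
    ∑ x : Fin (n + 1) → Tok, (∏ i, P (x i)) • h x =
      ∑ s, P s • ∑ u : Fin n → Tok, (∏ i, P (u i)) • h (Fin.cons s u) := by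
  rw [← (Fin.consEquiv (fun _ : Fin (n + 1) => Tok)).sum_comp, Fintype.sum_prod_type]
  refine Finset.sum_congr rfl fun s _ => ?_
  rw [Finset.smul_sum]
  refine Finset.sum_congr rfl fun u _ => ?_
  simp [Fin.consEquiv, Fin.prod_univ_succ, mul_smul]

theorem sum_append_sequences (P : Tok → ℝ) {a l : ℕ} (h : (Fin (a + l) → Tok) → ℝ) :
    ∑ x : Fin (a + l) → Tok, (∏ i, P (x i)) * h x =
      ∑ s : Fin l → Tok, (∏ i, P (s i)) *
        ∑ u : Fin a → Tok, (∏ i, P (u i)) * h (Fin.append u s) := by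
  rw [← (Fin.appendEquiv a l).sum_comp, Fintype.sum_prod_type, Finset.sum_comm]
  refine Finset.sum_congr rfl fun s _ => ?_
  rw [Finset.mul_sum]
  refine Finset.sum_congr rfl fun u _ => ?_
  simp [Fin.appendEquiv, Fin.prod_univ_add]
  ring

theorem sum_prod_sequences_eq_one {P : Tok → ℝ} (hP : ∑ s, P s = 1) (n : ℕ) :
    ∑ x : Fin n → Tok, ∏ i, P (x i) = 1 := by
  rw [← Fintype.sum_pow, hP, one_pow]

variable {H : Type*} [NormedAddCommGroup H] [InnerProductSpace ℝ H]

theorem mean_sum_sequences {P : Tok → ℝ} (hP : ∑ s, P s = 1) {n : ℕ} (ξ : Fin n → Tok → H) :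
    ∑ u : Fin n → Tok, (∏ i, P (u i)) • ∑ j, ξ j (u j) = ∑ j, ∑ s, P s • ξ j s := by
  induction n with
  | zero => simp
  | succ n ih =>
    rw [sum_cons_sequences]
    simp only [Fin.sum_univ_succ, Fin.cons_zero, Fin.cons_succ, smul_add, Finset.sum_add_distrib]
    simp only [ih, ← Finset.sum_smul, sum_prod_sequences_eq_one hP, one_smul, hP]

/-- Independence removes all covariances, so only the diagonal second moments remain; the squared
means on the diagonal are discarded. The norm of the total mean is kept because in the application
to values the summands are centered only after summing over all residues. -/
theorem second_moment_sum_sequences_le {P : Tok → ℝ} (hP : ∑ s, P s = 1) {n : ℕ}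
    (ξ : Fin n → Tok → H) :
    ∑ u : Fin n → Tok, (∏ i, P (u i)) * ‖∑ j, ξ j (u j)‖ ^ 2 ≤
      ‖∑ j, ∑ s, P s • ξ j s‖ ^ 2 + ∑ j, ∑ s, P s * ‖ξ j s‖ ^ 2 := by
  induction n with
  | zero => simp
  | succ n ih =>
    have key := ih fun j => ξ j.succ
    have hmean := mean_sum_sequences hP fun j : Fin n => ξ j.succ
    set μ := ∑ j : Fin n, ∑ s, P s • ξ j.succ s with hμ
    set m := ∑ s, P s • ξ 0 s with hm
    have h1 := sum_cons_sequences P (fun x : Fin (n + 1) → Tok => ‖∑ j, ξ j (x j)‖ ^ 2)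
    simp only [smul_eq_mul] at h1
    rw [h1]
    have h2 : ∀ s, ∑ u : Fin n → Tok, (∏ i, P (u i)) *
        ‖∑ j, ξ j ((Fin.cons s u : Fin (n + 1) → Tok) j)‖ ^ 2 =
        ‖ξ 0 s‖ ^ 2 + 2 * inner ℝ (ξ 0 s) μ +
          ∑ u : Fin n → Tok, (∏ i, P (u i)) * ‖∑ j : Fin n, ξ j.succ (u j)‖ ^ 2 := by
      intro s
      rw [← hmean, inner_sum, Finset.mul_sum]
      have : ‖ξ 0 s‖ ^ 2 = ∑ u : Fin n → Tok, (∏ i, P (u i)) * ‖ξ 0 s‖ ^ 2 := by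
        rw [← Finset.sum_mul, sum_prod_sequences_eq_one hP, one_mul]
      rw [this, ← Finset.sum_add_distrib, ← Finset.sum_add_distrib]
      refine Finset.sum_congr rfl fun u _ => ?_
      rw [Fin.sum_univ_succ]
      simp only [Fin.cons_zero, Fin.cons_succ]
      rw [norm_add_sq_real, inner_smul_right]
      ring
    simp only [h2]
    have h3 : ∑ s, P s * (‖ξ 0 s‖ ^ 2 + 2 * inner ℝ (ξ 0 s) μ +
          ∑ u : Fin n → Tok, (∏ i, P (u i)) * ‖∑ j : Fin n, ξ j.succ (u j)‖ ^ 2) =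
        ∑ s, P s * ‖ξ 0 s‖ ^ 2 + 2 * inner ℝ m μ +
          ∑ u : Fin n → Tok, (∏ i, P (u i)) * ‖∑ j : Fin n, ξ j.succ (u j)‖ ^ 2 := by
      simp only [mul_add, Finset.sum_add_distrib, ← Finset.sum_mul, hP, one_mul]
      congr 2
      rw [hm, sum_inner, Finset.mul_sum]
      refine Finset.sum_congr rfl fun s _ => ?_
      rw [inner_smul_left]
      simp
      ring
    rw [h3, Fin.sum_univ_succ, Fin.sum_univ_succ, ← hm, ← hμ, norm_add_sq_real]
    nlinarith [sq_nonneg ‖m‖]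

theorem sum_mul_norm_le_sqrt {ι H : Type*} [SeminormedAddCommGroup H] (t : Finset ι) {p : ι → ℝ} (hp : ∀ i ∈ t, 0 ≤ p i)
    (hp1 : ∑ i ∈ t, p i = 1) (Z : ι → H) {c : ℝ} (hc : ∑ i ∈ t, p i * ‖Z i‖ ^ 2 ≤ c) :
    ∑ i ∈ t, p i * ‖Z i‖ ≤ √c := by
  apply Real.le_sqrt_of_sq_le
  have := Finset.sum_sq_le_sum_mul_sum_of_sq_le_mul t (r := fun i => p i * ‖Z i‖) (f := p)
    (g := fun i => p i * ‖Z i‖ ^ 2) hp (fun i hi => mul_nonneg (hp i hi) (by positivity))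
    (fun i _ => le_of_eq (by ring))
  rw [hp1, one_mul] at this
  exact this.trans hc

variable {Δ : ℕ}

/-- Prefix lengths are multiples of Δ so that every residue occurs equally often. -/
theorem sum_modNat {M : Type*} [AddCommMonoid M] (k : ℕ) (h : Fin Δ → M) :
    ∑ j : Fin (k * Δ), h j.modNat = k • ∑ r, h r := by
  rw [← finProdFinEquiv.sum_comp, Fintype.sum_prod_type]
  have : ∀ (b : Fin k) (r : Fin Δ), (finProdFinEquiv (b, r)).modNat = r := fun b r =>
    congrArg Prod.snd (finProdFinEquiv.symm_apply_apply (b, r))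
  simp [this]

/-- An indicator of mean c has variance c - c² ≤ c, so the variance of the number of hits is at most
its mean. -/
theorem variance_count_le {P : Tok → ℝ} (hP : ∑ s, P s = 1) (k : ℕ)
    (G : Tok → Fin Δ → Prop) [∀ z r, Decidable (G z r)] :
    ∑ u : Fin (k * Δ) → Tok, (∏ i, P (u i)) *
        (∑ j, (if G (u j) j.modNat then 1 else 0) -
          k * ∑ r, ∑ z, P z * (if G z r then 1 else 0)) ^ 2 ≤
      k * ∑ r, ∑ z, P z * (if G z r then (1 : ℝ) else 0) := by
  set c : Fin Δ → ℝ := fun r => ∑ z, P z * (if G z r then 1 else 0) with hc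
  have h := second_moment_sum_sequences_le (H := ℝ) hP
    (fun (j : Fin (k * Δ)) (z : Tok) => (if G z j.modNat then (1 : ℝ) else 0) - c j.modNat)
  have hm : ∀ r : Fin Δ, ∑ z, P z • ((if G z r then (1 : ℝ) else 0) - c r) = 0 := by
    intro r
    simp only [smul_eq_mul, mul_sub, Finset.sum_sub_distrib, ← Finset.sum_mul, hP, one_mul]
    simp [hc]
  simp only [hm, Finset.sum_const_zero, norm_zero, ne_eq, OfNat.ofNat_ne_zero, not_false_eq_true,
    zero_pow, zero_add, Finset.sum_sub_distrib, Real.norm_eq_abs, sq_abs] at h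
  rw [sum_modNat k c, sum_modNat k (fun r => ∑ z, P z * ((if G z r then (1 : ℝ) else 0) - c r) ^ 2),
    nsmul_eq_mul, nsmul_eq_mul] at h
  refine h.trans ?_
  gcongr with r
  have h1 : ∀ z, P z * ((if G z r then (1 : ℝ) else 0) - c r) ^ 2 =
      P z * (if G z r then (1 : ℝ) else 0) -
        2 * c r * (P z * (if G z r then (1 : ℝ) else 0)) + c r ^ 2 * P z := by
    intro z; split_ifs <;> ring
  simp only [h1, Finset.sum_add_distrib, Finset.sum_sub_distrib, ← Finset.mul_sum, hP]
  change c r - 2 * c r * c r + c r ^ 2 * 1 ≤ c r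
  nlinarith [sq_nonneg (c r)]

theorem second_moment_deviation_le {P : Tok → ℝ} (hP : ∑ s, P s = 1) (hP0 : ∀ s, 0 ≤ P s) (k : ℕ)
    (G : Tok → Fin Δ → Prop) [∀ z r, Decidable (G z r)] (v : Tok → Fin Δ → H) (w : H) {ρ : ℝ}
    (hv : ∀ z r, ‖v z r - w‖ ≤ ρ)
    (hw : ∑ r, ∑ z, P z • (if G z r then (1 : ℝ) else 0) • (v z r - w) = 0) :
    ∑ u : Fin (k * Δ) → Tok, (∏ i, P (u i)) *
        ‖∑ j, (if G (u j) j.modNat then (1 : ℝ) else 0) • (v (u j) j.modNat - w)‖ ^ 2 ≤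
      ρ ^ 2 * (k * ∑ r, ∑ z, P z * (if G z r then (1 : ℝ) else 0)) := by
  have h := second_moment_sum_sequences_le hP (fun (j : Fin (k * Δ)) (z : Tok) =>
    (if G z j.modNat then (1 : ℝ) else 0) • (v z j.modNat - w))
  rw [sum_modNat k (fun r => ∑ z, P z • (if G z r then (1 : ℝ) else 0) • (v z r - w)), hw,
    sum_modNat k (fun r => ∑ z, P z * ‖(if G z r then (1 : ℝ) else 0) • (v z r - w)‖ ^ 2)] at h
  refine h.trans ?_
  rw [smul_zero, norm_zero, nsmul_eq_mul, mul_left_comm]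
  simp only [ne_eq, OfNat.ofNat_ne_zero, not_false_eq_true, zero_pow, zero_add]
  refine mul_le_mul_of_nonneg_left ?_ (Nat.cast_nonneg k)
  rw [Finset.mul_sum]
  refine Finset.sum_le_sum fun r _ => ?_
  rw [Finset.mul_sum]
  refine Finset.sum_le_sum fun z _ => ?_
  rw [mul_left_comm]
  refine mul_le_mul_of_nonneg_left ?_ (hP0 z)
  split_ifs
  · simpa using pow_le_pow_left₀ (norm_nonneg _) (hv z r) 2
  · simp

end Sequences

/-! ### Gamma moments and lower tails of Dirichlet coordinates -/

section Dirichlet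

open MeasureTheory ProbabilityTheory

theorem measurable_gammaPDF (a r : ℝ) : Measurable (gammaPDF a r) :=
  (measurable_gammaPDFReal a r).ennreal_ofReal

theorem lintegral_exp_mul_gammaMeasure {a c : ℝ} (ha : 0 < a) (hc : c < 1) :
    ∫⁻ x, ENNReal.ofReal (Real.exp (c * x)) ∂(gammaMeasure a 1) =
      ENNReal.ofReal ((1 - c) ^ (-a)) := by
  have hc' : 0 < 1 - c := sub_pos.2 hc
  rw [gammaMeasure, lintegral_withDensity_eq_lintegral_mul _
    (measurable_gammaPDF a 1) (by fun_prop)]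
  have h : ∀ x, (gammaPDF a 1 * fun x => ENNReal.ofReal (Real.exp (c * x))) x =
      ENNReal.ofReal ((1 - c) ^ (-a)) * gammaPDF a (1 - c) x := by
    intro x
    rcases lt_or_ge x 0 with hx | hx
    · simp [gammaPDF_of_neg hx]
    · rw [Pi.mul_apply, gammaPDF_of_nonneg hx, gammaPDF_of_nonneg hx, ← ENNReal.ofReal_mul
        (by positivity), ← ENNReal.ofReal_mul (by positivity)]
      congr 1
      rw [Real.rpow_neg hc'.le, Real.one_rpow, mul_assoc, ← Real.exp_add]
      have : (1 - c) ^ a ≠ 0 := (Real.rpow_pos_of_pos hc' a).ne'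
      field_simp
      ring_nf
  simp_rw [h]
  rw [lintegral_const_mul _ (measurable_gammaPDF a _),
    lintegral_gammaPDF_eq_one ha hc', mul_one]

theorem integrable_exp_mul_gammaMeasure {a c : ℝ} (ha : 0 < a) (hc : c < 1) :
    Integrable (fun x => Real.exp (c * x)) (gammaMeasure a 1) := by
  refine ⟨by fun_prop, ?_⟩
  rw [hasFiniteIntegral_iff_ofReal (ae_of_all _ fun x => (Real.exp_pos _).le),
    lintegral_exp_mul_gammaMeasure ha hc]
  exact ENNReal.ofReal_lt_top

theorem integral_exp_mul_gammaMeasure {a c : ℝ} (ha : 0 < a) (hc : c < 1) :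
    ∫ x, Real.exp (c * x) ∂(gammaMeasure a 1) = (1 - c) ^ (-a) := by
  rw [integral_eq_lintegral_of_nonneg_ae (ae_of_all _ fun x => (Real.exp_pos _).le) (by fun_prop),
    lintegral_exp_mul_gammaMeasure ha hc, ENNReal.toReal_ofReal]
  exact Real.rpow_nonneg (sub_pos.2 hc).le _

theorem ae_pos_gammaMeasure (a : ℝ) : ∀ᵐ x ∂(gammaMeasure a 1), 0 < x := by
  rw [gammaMeasure, ae_withDensity_iff (measurable_gammaPDF a 1)]
  have h0 : ∀ᵐ x : ℝ, x ≠ 0 := by simp [ae_iff]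
  filter_upwards [h0] with x hx h
  by_contra hx'
  exact h (gammaPDF_of_neg (lt_of_le_of_ne (not_lt.1 hx') hx))

variable {Tok : Type u} [Fintype Tok] {α : Tok → ℝ}

theorem measurable_dirichlet_normalize :
    Measurable fun (G : Tok → ℝ) s => G s / ∑ t, G t := by
  fun_prop

theorem isProbabilityMeasure_dirichletMeasure (hα : ∀ s, 0 < α s) :
    IsProbabilityMeasure (dirichletMeasure α) := by
  have := fun s => isProbabilityMeasure_gammaMeasure (hα s) one_pos
  exact Measure.isProbabilityMeasure_map measurable_dirichlet_normalize.aemeasurable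

theorem ae_pos_pi_gammaMeasure (hα : ∀ s, 0 < α s) :
    ∀ᵐ G ∂(Measure.pi fun s => gammaMeasure (α s) 1), ∀ s, 0 < G s := by
  have := fun s => isProbabilityMeasure_gammaMeasure (hα s) one_pos
  exact ae_all_iff.2 fun s => (Measure.tendsto_eval_ae_ae (μ := fun s => gammaMeasure (α s) 1)
    (i := s)).eventually (ae_pos_gammaMeasure (α s))

theorem ae_mem_simplex_dirichletMeasure [Nonempty Tok] (hα : ∀ s, 0 < α s) :
    ∀ᵐ P ∂(dirichletMeasure α), (∀ s, 0 ≤ P s) ∧ ∑ s, P s = 1 := by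
  refine (ae_map_iff measurable_dirichlet_normalize.aemeasurable ?_).2 ?_
  · have : {P : Tok → ℝ | (∀ s, 0 ≤ P s) ∧ ∑ s, P s = 1} =
        (⋂ s, {P | 0 ≤ P s}) ∩ {P | ∑ s, P s = 1} := by ext; simp
    rw [this]
    exact (MeasurableSet.iInter fun s => measurableSet_le measurable_const
      (measurable_pi_apply s)).inter (measurableSet_eq_fun (by fun_prop) measurable_const)
  · filter_upwards [ae_pos_pi_gammaMeasure hα] with G hG
    have hs : 0 < ∑ t, G t := Finset.sum_pos (fun t _ => hG t) Finset.univ_nonempty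
    refine ⟨fun s => (div_pos (hG s) hs).le, ?_⟩
    rw [← Finset.sum_div, div_self hs.ne']

/-- Chernoff bound: the event is a linear inequality between independent Gamma variables, whose
exponential moments are explicit. -/
theorem dirichletMeasure_coord_lt_le [Nonempty Tok] (hα : ∀ s, 0 < α s) {q : ℝ} (hq : 0 < q)
    (s : Tok) :
    (dirichletMeasure α).real {P | P s < q} ≤ (2 : ℝ) ^ (∑ t, α t) * q ^ α s := by
  classical
  have hprob := fun s => isProbabilityMeasure_gammaMeasure (hα s) one_pos
  have := isProbabilityMeasure_dirichletMeasure hα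
  set ν := Measure.pi fun s => gammaMeasure (α s) 1 with hν
  -- With these coefficients, G s < q ∑ G is equivalent to ∑ c t * G t > 0. Each t ≠ s contributes
  -- the moment 2 ^ α t, and s contributes at most (2q) ^ α s.
  set c : Tok → ℝ := fun t => 1 / 2 - if t = s then 1 / (2 * q) else 0 with hcdef
  have hc : ∀ t, c t < 1 := by
    intro t
    simp only [hcdef]
    split_ifs
    · have : 0 < 1 / (2 * q) := by positivity
      linarith
    · norm_num
  have hint : Integrable (fun G : Tok → ℝ => ∏ t, Real.exp (c t * G t)) ν :=
    Integrable.fintype_prod fun t => integrable_exp_mul_gammaMeasure (hα t) (hc t)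
  have hmarkov := mul_meas_ge_le_integral_of_nonneg
    (ae_of_all ν fun G => Finset.prod_nonneg fun t _ => (Real.exp_pos (c t * G t)).le) hint 1
  rw [integral_fintype_prod_eq_prod (fun t x => Real.exp (c t * x)), one_mul] at hmarkov
  simp only [integral_exp_mul_gammaMeasure (hα _) (hc _)] at hmarkov
  have hsub : (dirichletMeasure α).real {P | P s < q} ≤
      ν.real {G | 1 ≤ ∏ t, Real.exp (c t * G t)} := by
    rw [measureReal_def, measureReal_def, dirichletMeasure,
      Measure.map_apply measurable_dirichlet_normalize
        (measurableSet_lt (measurable_pi_apply s) measurable_const)]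
    refine ENNReal.toReal_mono (measure_ne_top _ _) (measure_mono_ae ?_)
    filter_upwards [ae_pos_pi_gammaMeasure hα] with G hG hGs
    have hs : 0 < ∑ t, G t := Finset.sum_pos (fun t _ => hG t) Finset.univ_nonempty
    have hGs' : G s / ∑ t, G t < q := hGs
    rw [div_lt_iff₀ hs] at hGs'
    change 1 ≤ ∏ t, Real.exp (c t * G t)
    rw [← Real.exp_sum, Real.one_le_exp_iff]
    simp only [hcdef, sub_mul, Finset.sum_sub_distrib, ← Finset.mul_sum, ite_mul, zero_mul,
      Finset.sum_ite_eq', Finset.mem_univ, if_true]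
    rw [sub_nonneg, div_mul_eq_mul_div, one_mul, div_le_iff₀ (by positivity)]
    linarith
  refine hsub.trans (hmarkov.trans ?_)
  have h2 : (2 : ℝ) ^ (∑ t, α t) * q ^ α s =
      ∏ t, ((2 : ℝ) ^ α t * if t = s then q ^ α s else 1) := by
    rw [Finset.prod_mul_distrib, Finset.prod_ite_eq' Finset.univ s,
      if_pos (Finset.mem_univ s), Real.rpow_sum_of_pos two_pos]
  rw [h2]
  refine Finset.prod_le_prod (fun t _ => Real.rpow_nonneg (sub_pos.2 (hc t)).le _) fun t _ => ?_
  by_cases hts : t = s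
  · subst hts
    rw [if_pos rfl, ← Real.mul_rpow two_pos.le hq.le]
    have : (2 * q) ^ α t = (1 / (2 * q)) ^ (-α t) := by
      rw [one_div, Real.inv_rpow (by positivity), ← Real.rpow_neg (by positivity), neg_neg]
    rw [this]
    refine Real.rpow_le_rpow_of_nonpos (by positivity) ?_ (neg_nonpos.2 (hα t).le)
    simp only [hcdef, if_true]
    linarith
  · simp only [hcdef, if_neg hts, mul_one, sub_zero]
    refine le_of_eq ?_
    rw [Real.rpow_neg (by norm_num), ← Real.inv_rpow (by norm_num)]
    norm_num

theorem dirichletMeasure_exists_lt_le [Nonempty Tok] (hα : ∀ s, 0 < α s) {q : ℝ} (hq : 0 < q)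
    (hq1 : q ≤ 1) :
    (dirichletMeasure α).real {P | ∃ s, P s < q} ≤
      Fintype.card Tok * ((2 : ℝ) ^ (∑ t, α t) * q ^ (⨅ s, α s)) := by
  have := isProbabilityMeasure_dirichletMeasure hα
  have : {P : Tok → ℝ | ∃ s, P s < q} = ⋃ s, {P | P s < q} := by ext; simp
  rw [this]
  refine (measureReal_iUnion_fintype_le _).trans ?_
  rw [← nsmul_eq_mul]
  refine Finset.sum_le_card_nsmul _ _ _ fun s _ => (dirichletMeasure_coord_lt_le hα hq s).trans ?_
  refine mul_le_mul_of_nonneg_left ?_ (by positivity)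
  exact Real.rpow_le_rpow_of_exponent_ge hq hq1 (ciInf_le (Set.finite_range α).bddBelow s)

variable {d k m d' k' m' o : ℕ}

theorem measurable_errorGiven (f : LimitTransformer Tok d k m o)
    (g : LimitTransformer Tok d' k' m' o) (p n : ℕ) : Measurable (errorGiven f g p n) := by
  unfold errorGiven
  fun_prop

theorem integrable_errorGiven [Nonempty Tok] (hα : ∀ s, 0 < α s) (f : LimitTransformer Tok d k m o)
    (g : LimitTransformer Tok d' k' m' o) (p n : ℕ) :
    Integrable (errorGiven f g p n) (dirichletMeasure α) := by
  have := isProbabilityMeasure_dirichletMeasure hα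
  refine Integrable.of_bound (measurable_errorGiven f g p n).aestronglyMeasurable
    (∑ x : Fin n → Tok, ‖f.output p x - g.output p x‖) ?_
  filter_upwards [ae_mem_simplex_dirichletMeasure hα] with P hP
  have h1 : ∀ s, P s ≤ 1 := fun s =>
    hP.2 ▸ Finset.single_le_sum (fun t _ => hP.1 t) (Finset.mem_univ s)
  rw [errorGiven, Real.norm_of_nonneg (Finset.sum_nonneg fun x _ =>
    mul_nonneg (Finset.prod_nonneg fun i _ => hP.1 _) (norm_nonneg _))]
  refine Finset.sum_le_sum fun x _ => mul_le_of_le_one_left (norm_nonneg _) ?_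
  exact Finset.prod_le_one (fun i _ => hP.1 _) fun i _ => h1 _

end Dirichlet

/-! ### Lipschitz and oscillation bounds, hard attention, positivity of the margin -/

theorem lipschitzWith_lipConst {m n : ℕ} {ψ : Vec m → Vec n} {K : ℝ≥0} (hψ : LipschitzWith K ψ) :
    LipschitzWith (lipConst ψ) ψ := by
  refine LipschitzWith.of_dist_le_mul fun x y => ?_
  rcases eq_or_ne x y with rfl | hxy
  · simp
  · have hpos : 0 < nndist x y := by simpa [pos_iff_ne_zero] using hxy
    have : nndist (ψ x) (ψ y) / nndist x y ≤ lipConst ψ :=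
      le_csInf ⟨K, hψ⟩ fun c hc => (div_le_iff₀ hpos).2 (by exact_mod_cast hc.dist_le_mul x y)
    exact_mod_cast (div_le_iff₀ hpos).1 this

theorem norm_inv_sum_smul_sum_le {ι H : Type*} [NormedAddCommGroup H] [NormedSpace ℝ H]
    (t : Finset ι) {w : ι → ℝ} (hw : ∀ i ∈ t, 0 ≤ w i) {v : ι → H} {ρ : ℝ} (hρ : 0 ≤ ρ)
    (hv : ∀ i ∈ t, ‖v i‖ ≤ ρ) : ‖(∑ i ∈ t, w i)⁻¹ • ∑ i ∈ t, w i • v i‖ ≤ ρ := by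
  have hs : 0 ≤ ∑ i ∈ t, w i := Finset.sum_nonneg hw
  have h : ‖∑ i ∈ t, w i • v i‖ ≤ (∑ i ∈ t, w i) * ρ := by
    rw [Finset.sum_mul]
    refine norm_sum_le_of_le t fun i hi => ?_
    rw [norm_smul, Real.norm_of_nonneg (hw i hi)]
    exact mul_le_mul_of_nonneg_left (hv i hi) (hw i hi)
  rw [norm_smul, norm_inv, Real.norm_of_nonneg hs]
  rcases hs.eq_or_lt with h0 | h0
  · simpa [← h0] using hρ
  · rwa [inv_mul_le_iff₀ h0]

theorem roundOff_nonneg {p : ℕ} {t : ℝ} (ht : 0 ≤ t) : 0 ≤ roundOff p t := by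
  unfold roundOff; split_ifs <;> simp [ht]

namespace LimitTransformer

variable {Tok : Type u} {d k m o n : ℕ} (f : LimitTransformer Tok d k m o)

/-- The residual multilayer perceptron followed by the unembedding. -/
noncomputable def post (Y : Vec d) : Vec o := f.U (Y + f.B (f.ψ (f.A Y + f.b)))

/-- A Lipschitz constant of `post`. -/
noncomputable def postLip : ℝ := ‖f.U‖ * (1 + ‖f.A‖ * ‖f.B‖ * (lipConst f.ψ : ℝ))

theorem postLip_nonneg : 0 ≤ f.postLip := by unfold postLip; positivity

theorem norm_post_sub_le (Y Y' : Vec d) : ‖f.post Y - f.post Y'‖ ≤ f.postLip * ‖Y - Y'‖ := by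
  have h1 : ‖f.ψ (f.A Y + f.b) - f.ψ (f.A Y' + f.b)‖ ≤ lipConst f.ψ * (‖f.A‖ * ‖Y - Y'‖) := by
    have := (lipschitzWith_lipConst f.lipschitz_ψ).dist_le_mul (f.A Y + f.b) (f.A Y' + f.b)
    rw [dist_eq_norm, dist_eq_norm, add_sub_add_right_eq_sub, ← map_sub] at this
    exact this.trans (mul_le_mul_of_nonneg_left (f.A.le_opNorm _) (NNReal.coe_nonneg _))
  have h2 := (f.B.le_opNorm (f.ψ (f.A Y + f.b) - f.ψ (f.A Y' + f.b))).trans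
    (mul_le_mul_of_nonneg_left h1 (norm_nonneg _))
  have h3 : f.post Y - f.post Y' =
      f.U ((Y - Y') + f.B (f.ψ (f.A Y + f.b) - f.ψ (f.A Y' + f.b))) := by
    simp only [post, map_sub, map_add]; abel
  rw [h3]
  refine (f.U.le_opNorm _).trans ?_
  rw [postLip, mul_assoc]
  refine mul_le_mul_of_nonneg_left ((norm_add_le _ _).trans ?_) (norm_nonneg _)
  calc _ ≤ ‖Y - Y'‖ + ‖f.B‖ * (lipConst f.ψ * (‖f.A‖ * ‖Y - Y'‖)) := by gcongr
    _ = _ := by ring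

variable {f}

theorem IsPeriodic.embed_add_mul {Δ : ℕ} (hf : f.IsPeriodic Δ) (s : Tok) (i b : ℤ) :
    f.embed s (Δ * b + i) = f.embed s i := by
  have h : Function.Periodic f.pos (Δ : ℤ) := hf
  have h2 := h.int_mul b i
  rw [Int.cast_id] at h2
  rw [embed, embed, add_comm (_ * b), mul_comm, h2]

theorem IsPeriodic.embed_emod {Δ : ℕ} (hf : f.IsPeriodic Δ) (s : Tok) (i : ℤ) :
    f.embed s (i % Δ) = f.embed s i := by
  conv_rhs => rw [← Int.mul_ediv_add_emod i Δ]
  rw [hf.embed_add_mul]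

theorem IsPeriodic.exists_fin {Δ : ℕ} (hf : f.IsPeriodic Δ) (hΔ : 0 < Δ) (i : ℤ) :
    ∃ r : Fin Δ, ∀ s, f.embed s i = f.embed s (r : ℕ) := by
  have hΔ' : (0 : ℤ) < Δ := by exact_mod_cast hΔ
  have h0 := Int.emod_nonneg i hΔ'.ne'
  have h1 := Int.emod_lt_of_pos i hΔ'
  refine ⟨⟨(i % Δ).toNat, by omega⟩, fun s => ?_⟩
  rw [← hf.embed_emod s i]
  simp [Int.toNat_of_nonneg h0]

theorem IsPeriodic.exists_radius [Fintype Tok] [Nonempty Tok] {Δ : ℕ} (hf : f.IsPeriodic Δ)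
    (hΔ : 0 < Δ) :
    ∃ ρ : ℝ, 0 ≤ ρ ∧ (∀ z i, ‖f.V (f.embed z i)‖ ≤ ρ) ∧ (∀ z i, ‖f.embed z i‖ ≤ ρ) ∧
      f.postLip * ρ ≤ f.normBound Δ := by
  have : Nonempty (Fin Δ) := ⟨⟨0, hΔ⟩⟩
  obtain ⟨q, hq⟩ := Finite.exists_max fun q : Tok × Fin Δ =>
    ‖f.V (f.embed q.1 (q.2 : ℕ))‖ + ‖f.embed q.1 (q.2 : ℕ)‖
  set ρ := ‖f.V (f.embed q.1 (q.2 : ℕ))‖ + ‖f.embed q.1 (q.2 : ℕ)‖ with hρ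
  refine ⟨ρ, by positivity, fun z i => ?_, fun z i => ?_, ?_⟩
  · obtain ⟨r, hr⟩ := hf.exists_fin hΔ i
    rw [hr]
    exact (le_add_of_nonneg_right (norm_nonneg _)).trans (hq (z, r))
  · obtain ⟨r, hr⟩ := hf.exists_fin hΔ i
    rw [hr]
    exact (le_add_of_nonneg_left (norm_nonneg _)).trans (hq (z, r))
  · refine le_trans ?_ (le_ciSup (Set.finite_range _).bddAbove q)
    exact mul_le_mul_of_nonneg_left (le_add_of_nonneg_right (norm_nonneg _)) f.postLip_nonneg

variable (f)

/-- The output of the attention head at position `i`, if `i` is the last position. -/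
noncomputable def head (p : ℕ) (x : Fin n → Tok) (i : Fin n) : Vec d :=
  (∑ j, f.weight p x i j)⁻¹ • ∑ j, f.weight p x i j • f.V (f.feature x j)

theorem output_eq_post (p : ℕ) (x : Fin n → Tok) {i : Fin n} (hi : ∀ j, j ≤ i) :
    f.output p x = f.post (f.feature x i + f.head p x i) := by
  have hn : 0 < n := i.pos
  have hI : Finset.Iic i = Finset.univ := by
    ext j; simp [hi j]
  have hl : (⟨n - 1, Nat.sub_lt hn Nat.one_pos⟩ : Fin n) = i :=
    le_antisymm (hi _) (Fin.le_def.2 (Nat.le_sub_one_of_lt i.isLt))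
  rw [output, dif_pos hn, hl, outputAt, preAct, hI, post, head]

theorem weight_nonneg (p : ℕ) (x : Fin n → Tok) (i j : Fin n) : 0 ≤ f.weight p x i j :=
  roundOff_nonneg (Real.exp_pos _).le

variable {f}

theorem norm_head_le {ρ : ℝ} (hρ : 0 ≤ ρ) (hV : ∀ z i, ‖f.V (f.embed z i)‖ ≤ ρ) (p : ℕ)
    (x : Fin n → Tok) (i : Fin n) : ‖f.head p x i‖ ≤ ρ :=
  norm_inv_sum_smul_sum_le _ (fun _ _ => f.weight_nonneg _ _ _ _) hρ fun _ _ => hV _ _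

/-- Residual and head each have norm at most ρ, so two pre-activations differ by at most 4ρ. Only
differences of outputs can be bounded this way: nothing limits the size of `f.ψ 0`. -/
theorem IsPeriodic.norm_output_sub_output_le [Fintype Tok] [Nonempty Tok] {Δ : ℕ}
    (hf : f.IsPeriodic Δ) (hΔ : 0 < Δ) (p : ℕ) {n' : ℕ} (hn : 0 < n) (hn' : 0 < n')
    (x : Fin n → Tok) (x' : Fin n' → Tok) :
    ‖f.output p x - f.output p x'‖ ≤ 4 * f.normBound Δ := by
  obtain ⟨n, rfl⟩ : ∃ k, n = k + 1 := ⟨n - 1, by omega⟩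
  obtain ⟨n', rfl⟩ : ∃ k, n' = k + 1 := ⟨n' - 1, by omega⟩
  obtain ⟨ρ, hρ, hV, hE, hρL⟩ := hf.exists_radius hΔ
  rw [output_eq_post f p x Fin.le_last, output_eq_post f p x' Fin.le_last]
  have h : ∀ {n : ℕ} (x : Fin (n + 1) → Tok),
      ‖f.feature x (Fin.last n) + f.head p x (Fin.last n)‖ ≤ ρ + ρ := fun x =>
    (norm_add_le _ _).trans (add_le_add (hE _ _) (norm_head_le hρ hV p x _))
  have h2 : ‖f.feature x (Fin.last n) + f.head p x (Fin.last n) - (f.feature x' (Fin.last n') + f.head p x' (Fin.last n'))‖ ≤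
      4 * ρ := by
    linarith [norm_sub_le (f.feature x (Fin.last n) + f.head p x (Fin.last n))
      (f.feature x' (Fin.last n') + f.head p x' (Fin.last n')), h x, h x']
  linarith [f.norm_post_sub_le _ _ |>.trans (mul_le_mul_of_nonneg_left h2 f.postLip_nonneg)]

theorem logit_mem_logitSet (ht : f.IsTranslationInvariant) (x : Fin n → Tok) {i j : Fin n}
    (hij : j ≤ i) : f.logit x i j ∈ f.logitSet (x i) ((i : ℕ) + 1) := by
  have hij' : (j : ℕ) ≤ i := hij
  refine ⟨x j, i - j, ?_⟩
  have h1 : ((i : ℕ) : ℤ) + 1 - ((i - j : ℕ) : ℤ) = (j : ℕ) + 1 := by omega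
  have h2 := ht 1 (((i - j : ℕ) : ℤ) + 1) (j : ℕ)
  have h3 : ((i - j : ℕ) : ℤ) + 1 + (j : ℕ) = (i : ℕ) + 1 := by omega
  rw [h1, ← h2, h3, add_comm (1 : ℤ)]
  rfl

/-- A logit below the maximum is at least γ below, so its weight is at most n ^ (-γ) ≤ 2 ^ (-p) and
is rounded to 0. The maximum has weight 1 > 2 ^ (-p). -/
theorem weight_eq_ite (ht : f.IsTranslationInvariant) {p : ℕ} (hp : 0 < p) {γ : ℝ≥0∞}
    (hγ : γ ≠ 0) (hγf : γ ≤ f.logitMargin) (x : Fin n → Tok)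
    (hn : (2 : ℝ) ^ ((p : ℝ≥0∞) / γ).toReal ≤ n) {i j : Fin n} (hij : j ≤ i) :
    f.weight p x i j = if f.logit x i j = f.maxLogit x i then 1 else 0 := by
  have h2p : (1 : ℝ) < 2 ^ p := one_lt_pow₀ one_lt_two hp.ne'
  split_ifs with h
  · rw [weight, roundOff, h, sub_self, mul_zero, Real.exp_zero, abs_one, if_neg]
    exact not_le.2 (inv_lt_one_of_one_lt₀ h2p)
  · have hle : f.logit x i j ≤ f.maxLogit x i := Finset.le_sup' (f.logit x i) (Finset.mem_Iic.2 hij)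
    have hlt := lt_of_le_of_ne hle h
    obtain ⟨j', hj', hmax⟩ := Finset.exists_mem_eq_sup' ⟨i, Finset.mem_Iic.2 le_rfl⟩ (f.logit x i)
    have hγle : γ ≤ ENNReal.ofReal (f.maxLogit x i - f.logit x i j) := by
      refine hγf.trans ?_
      refine iInf₂_le_of_le (x i) ((i : ℕ) + 1) (iInf₂_le_of_le (f.maxLogit x i) ?_
        (iInf₂_le_of_le _ (logit_mem_logitSet ht x hij) (iInf_le _ hlt)))
      rw [maxLogit, hmax]
      exact logit_mem_logitSet ht x (Finset.mem_Iic.1 hj')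
    have hγtop : γ ≠ ⊤ := ne_top_of_le_ne_top ENNReal.ofReal_ne_top hγle
    have hγr : 0 < γ.toReal := ENNReal.toReal_pos hγ hγtop
    have hγd : γ.toReal ≤ f.maxLogit x i - f.logit x i j :=
      ENNReal.toReal_le_of_le_ofReal (sub_pos.2 hlt).le hγle
    rw [weight, roundOff, if_pos]
    rw [abs_of_pos (Real.exp_pos _), ← Real.exp_log (pow_pos two_pos p : (0 : ℝ) < 2 ^ p),
      ← Real.exp_neg, Real.exp_le_exp, Real.log_pow]
    rw [ENNReal.toReal_div, ENNReal.toReal_natCast] at hn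
    have hlog := Real.log_le_log (Real.rpow_pos_of_pos two_pos _) hn
    rw [Real.log_rpow two_pos, div_mul_eq_mul_div, div_le_iff₀ hγr] at hlog
    have h0 : 0 ≤ Real.log n := Real.log_natCast_nonneg n
    nlinarith [mul_le_mul_of_nonneg_left hγd h0]

variable [Fintype Tok] {Δ τ : ℕ}

theorem IsPeriodic.normBound_nonneg [Nonempty Tok] (hf : f.IsPeriodic Δ) (hΔ : 0 < Δ) :
    0 ≤ f.normBound Δ := by
  obtain ⟨ρ, hρ, -, -, h⟩ := hf.exists_radius hΔ
  exact (mul_nonneg f.postLip_nonneg hρ).trans h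

theorem finite_iUnion_logitSet (hf : f.IsPeriodic Δ) (hΔ : 0 < Δ) (hτ : f.IsLocal τ) :
    (⋃ (y : Tok) (i : ℤ), f.logitSet y i).Finite := by
  refine (Set.finite_range fun t : (Tok × Fin Δ) × (Tok × Fin Δ) × Fin (τ + 1 + 1) =>
    f.attn t.1.1 (t.1.2 : ℕ) t.2.1.1 (t.2.1.2 : ℕ) +
      f.φ 1 ((t.2.2 : ℕ) + 1)).subset ?_
  rintro a ha
  simp only [Set.mem_iUnion] at ha
  obtain ⟨y, i, z, r, rfl⟩ := ha
  obtain ⟨i', hi'⟩ := hf.exists_fin hΔ i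
  obtain ⟨j', hj'⟩ := hf.exists_fin hΔ (i - r)
  -- By locality `φ` vanishes at every distance r > τ, so τ + 1 represents them all.
  refine ⟨((y, i'), (z, j'), ⟨min r (τ + 1), by omega⟩), ?_⟩
  have hφ : f.φ 1 (((min r (τ + 1) : ℕ) : ℤ) + 1) = f.φ 1 (r + 1) := by
    rcases le_total r (τ + 1) with h | h
    · rw [min_eq_left h]
    · rw [min_eq_right h, hτ _ _ (by push_cast; omega), hτ _ _ (by omega)]
  simp only [attn, hi', hj', hφ]

/-- There are only finitely many logits. Positivity matters: for γ = 0 the exponent `(p / γ).toReal`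
would be the default value 0 and the length threshold would be void. -/
theorem logitMargin_pos (hf : f.IsPeriodic Δ) (hΔ : 0 < Δ) (hτ : f.IsLocal τ) :
    f.logitMargin ≠ 0 := by
  set D : Set ℝ := {x | ∃ a ∈ (⋃ (y : Tok) (i : ℤ), f.logitSet y i),
    ∃ a' ∈ (⋃ (y : Tok) (i : ℤ), f.logitSet y i), a' < a ∧ x = a - a'} with hD
  have hfin := finite_iUnion_logitSet hf hΔ hτ
  have hDfin : D.Finite := by
    refine ((hfin.prod hfin).image fun t => t.1 - t.2).subset ?_
    rintro x ⟨a, ha, a', ha', -, rfl⟩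
    exact ⟨(a, a'), ⟨ha, ha'⟩, rfl⟩
  have hle : ∀ δ : ℝ, (∀ x ∈ D, δ ≤ x) → ENNReal.ofReal δ ≤ f.logitMargin := by
    intro δ hδ
    simp only [logitMargin, le_iInf_iff]
    intro y i a ha a' ha' haa
    refine ENNReal.ofReal_le_ofReal (hδ _ ⟨a, ?_, a', ?_, haa, rfl⟩)
    · exact Set.mem_iUnion₂.2 ⟨y, i, ha⟩
    · exact Set.mem_iUnion₂.2 ⟨y, i, ha'⟩
  have hex : ∃ δ : ℝ, 0 < δ ∧ ∀ x ∈ D, δ ≤ x := by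
    rcases D.eq_empty_or_nonempty with h | h
    · exact ⟨1, one_pos, by simp [h]⟩
    · obtain ⟨x, hx, hmin⟩ := Set.exists_min_image D id hDfin h
      obtain ⟨a, -, a', -, haa, hxe⟩ := id hx
      exact ⟨x, hxe ▸ sub_pos.2 haa, hmin⟩
  obtain ⟨δ, hδ, h⟩ := hex
  exact ((ENNReal.ofReal_pos.2 hδ).trans_le (hle δ h)).ne'

end LimitTransformer

/-! ### Concentration of the attention head for a fixed suffix -/

/-- Chebyshev's inequality in pointwise form: if the total weight is below m / 2, the quadratic term
already exceeds the trivial bound 2ρ; otherwise the denominator is at least m / 2. Taking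
expectations afterwards needs no conditioning. -/
theorem norm_head_sub_le {ι κ H : Type*} [Fintype ι] [Fintype κ] [NormedAddCommGroup H]
    [NormedSpace ℝ H] {g : ι → ℝ} {w : κ → ℝ} (hw0 : ∀ t, 0 ≤ w t)
    (hw1 : ∀ t, w t ≤ 1) (v : ι → H) {v' : κ → H} {c h : H} {ρ m : ℝ} (hm : 0 < m)
    (hv' : ∀ t, ‖v' t‖ ≤ ρ) (hc : ‖c‖ ≤ ρ) (hh : ‖h‖ ≤ ρ)
    (heq : 0 < ∑ j, g j →
      h = (∑ j, g j + ∑ t, w t)⁻¹ • (∑ j, g j • v j + ∑ t, w t • v' t)) :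
    ‖h - c‖ ≤ 8 * ρ / m ^ 2 * (∑ j, g j - m) ^ 2 +
      2 / m * (‖∑ j, g j • (v j - c)‖ + 2 * Fintype.card κ * ρ) := by
  have hρ : 0 ≤ ρ := (norm_nonneg c).trans hc
  set W := ∑ j, g j with hW
  rcases lt_or_ge W (m / 2) with hlt | hge
  · have h1 : ‖h - c‖ ≤ 2 * ρ := by linarith [norm_sub_le h c]
    have h2 : m ^ 2 / 4 ≤ (W - m) ^ 2 := by nlinarith
    have h3 : 2 * ρ ≤ 8 * ρ / m ^ 2 * (W - m) ^ 2 := by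
      rw [div_mul_eq_mul_div, le_div_iff₀ (by positivity)]
      nlinarith
    have h4 : 0 ≤ 2 / m * (‖∑ j, g j • (v j - c)‖ + 2 * Fintype.card κ * ρ) := by positivity
    linarith
  · have hWpos : 0 < W := by linarith
    have hwt : 0 ≤ ∑ t, w t := Finset.sum_nonneg fun t _ => hw0 t
    have hS : 0 < W + ∑ t, w t := by linarith
    have hdiff : h - c = (W + ∑ t, w t)⁻¹ •
        (∑ j, g j • (v j - c) + ∑ t, w t • (v' t - c)) := by
      have hcc : c = (W + ∑ t, w t)⁻¹ • (W + ∑ t, w t) • c := by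
        rw [smul_smul, inv_mul_cancel₀ hS.ne', one_smul]
      conv_lhs => rw [heq hWpos, hcc, ← smul_sub]
      congr 1
      simp only [smul_sub, Finset.sum_sub_distrib, ← Finset.sum_smul, ← hW, add_smul]
      abel
    have hloc : ‖∑ t, w t • (v' t - c)‖ ≤ 2 * Fintype.card κ * ρ := by
      have : ∀ t ∈ Finset.univ, ‖w t • (v' t - c)‖ ≤ 2 * ρ := fun t _ => by
        rw [norm_smul, Real.norm_of_nonneg (hw0 t)]
        have h5 : ‖v' t - c‖ ≤ 2 * ρ := by linarith [norm_sub_le (v' t) c, hv' t]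
        exact (mul_le_of_le_one_left (norm_nonneg _) (hw1 t)).trans h5
      refine (norm_sum_le_of_le _ this).trans (le_of_eq ?_)
      rw [Finset.sum_const, nsmul_eq_mul, Finset.card_univ]
      ring
    have h6 : (W + ∑ t, w t)⁻¹ ≤ 2 / m := by
      rw [inv_le_comm₀ hS (by positivity), inv_div]
      linarith
    have h7 : ‖h - c‖ ≤ 2 / m * (‖∑ j, g j • (v j - c)‖ + 2 * Fintype.card κ * ρ) := by
      rw [hdiff, norm_smul, Real.norm_of_nonneg (inv_nonneg.2 hS.le)]
      exact mul_le_mul h6 ((norm_add_le _ _).trans (add_le_add le_rfl hloc)) (norm_nonneg _)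
        (by positivity)
    have : 0 ≤ 8 * ρ / m ^ 2 * (W - m) ^ 2 := by positivity
    linarith

theorem sum_mul_affine {ι : Type*} (t : Finset ι) {w : ι → ℝ} (hw : ∑ i ∈ t, w i = 1)
    (X Y : ι → ℝ) (A B C D : ℝ) :
    ∑ i ∈ t, w i * (A * (B * X i + C * (Y i + D))) =
      A * (B * ∑ i ∈ t, w i * X i + C * (∑ i ∈ t, w i * Y i + D)) := by
  have h : ∀ i, w i * (A * (B * X i + C * (Y i + D))) =
      A * B * (w i * X i) + A * C * (w i * Y i) + A * C * D * w i := fun i => by ring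
  simp only [h, Finset.sum_add_distrib, ← Finset.mul_sum, hw]
  ring

namespace LimitTransformer

variable {Tok : Type u} {d k m o Δ τ a l : ℕ} {f : LimitTransformer Tok d k m o}

theorem feature_append_left (hf : f.IsPeriodic Δ) (u : Fin (a * Δ) → Tok) (s : Fin l → Tok)
    (j : Fin (a * Δ)) :
    f.feature (Fin.append u s) (Fin.castAdd l j) = f.embed (u j) ((j.modNat : ℕ) + 1) := by
  have h : (((Fin.castAdd l j : Fin (a * Δ + l)) : ℕ) : ℤ) + 1 =
      Δ * ((j / Δ : ℕ) : ℤ) + (((j.modNat : ℕ) : ℤ) + 1) := by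
    rw [Fin.val_castAdd, Fin.coe_modNat, ← add_assoc]
    congr 1
    exact_mod_cast (Nat.div_add_mod (j : ℕ) Δ).symm
  rw [feature, Fin.append_left, h, hf.embed_add_mul]

theorem feature_append_right (hf : f.IsPeriodic Δ) (u : Fin (a * Δ) → Tok) (s : Fin l → Tok)
    (t : Fin l) : f.feature (Fin.append u s) (Fin.natAdd (a * Δ) t) = f.feature s t := by
  rw [feature, Fin.append_right, Fin.val_natAdd, feature]
  push_cast
  rw [mul_comm, add_assoc, hf.embed_add_mul]

theorem logit_append_right (hf : f.IsPeriodic Δ) (ht : f.IsTranslationInvariant)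
    (u : Fin (a * Δ) → Tok) (s : Fin l → Tok) (i j : Fin l) :
    f.logit (Fin.append u s) (Fin.natAdd (a * Δ) i) (Fin.natAdd (a * Δ) j) = f.logit s i j := by
  rw [logit, logit, feature_append_right hf, feature_append_right hf,
    ← ht ((j : ℕ) + 1) ((i : ℕ) + 1) ((a * Δ : ℕ) : ℤ)]
  congr 2 <;> rw [Fin.val_natAdd, Nat.cast_add] <;> ring

/-- A suffix of more than τ tokens separates the query from the whole prefix, so `φ` vanishes there.
-/
theorem logit_append_left (hf : f.IsPeriodic Δ) (hτ : f.IsLocal τ) (hl : τ ≤ l)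
    (u : Fin (a * Δ) → Tok) (s : Fin (l + 1) → Tok) (j : Fin (a * Δ)) :
    f.logit (Fin.append u s) (Fin.natAdd (a * Δ) (Fin.last l)) (Fin.castAdd (l + 1) j) =
      f.attn (s (Fin.last l)) (l + 1) (u j) ((j.modNat : ℕ) + 1) := by
  have hj := j.isLt
  rw [logit, feature_append_right hf, feature_append_left hf, hτ, add_zero]
  · rfl
  · rw [Fin.val_natAdd, Fin.val_castAdd, Fin.val_last]
    omega

theorem maxLogit_last_eq {n : ℕ} (x : Fin n → Tok) {i : Fin n} (hi : ∀ j, j ≤ i) {c : ℝ}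
    (hle : ∀ j, f.logit x i j ≤ c) {j : Fin n} (hj : f.logit x i j = c) :
    f.maxLogit x i = c := by
  refine le_antisymm (Finset.sup'_le _ _ fun j _ => hle j) ?_
  rw [← hj]
  exact Finset.le_sup' (f.logit x i) (Finset.mem_Iic.2 (hi j))

theorem exists_logit_eq_maxLogit {n : ℕ} (x : Fin n → Tok) (i : Fin n) :
    ∃ j, f.logit x i j = f.maxLogit x i := by
  obtain ⟨j, -, hj⟩ := Finset.exists_mem_eq_sup' ⟨i, Finset.mem_Iic.2 le_rfl⟩ (f.logit x i)
  exact ⟨j, hj.symm⟩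

theorem maxLogit_append (u : Fin a → Tok) (s : Fin l → Tok) {i : Fin (a + l)}
    (hi : ∀ j, j ≤ i) {c : ℝ}
    (hu : ∀ j, f.logit (Fin.append u s) i (Fin.castAdd l j) ≤ c)
    (hs : ∀ t, f.logit (Fin.append u s) i (Fin.natAdd a t) ≤ c)
    {j : Fin (a + l)} (hj : f.logit (Fin.append u s) i j = c) :
    f.maxLogit (Fin.append u s) i = c :=
  maxLogit_last_eq _ hi (Fin.addCases hu hs) hj

theorem head_append (hf : f.IsPeriodic Δ) (p : ℕ) (u : Fin (a * Δ) → Tok)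
    (s : Fin l → Tok) (i : Fin (a * Δ + l)) {w : Fin (a * Δ) → ℝ} {w' : Fin l → ℝ}
    (hw : ∀ j, f.weight p (Fin.append u s) i (Fin.castAdd l j) = w j)
    (hw' : ∀ t, f.weight p (Fin.append u s) i (Fin.natAdd (a * Δ) t) = w' t) :
    f.head p (Fin.append u s) i = (∑ j, w j + ∑ t, w' t)⁻¹ •
      (∑ j, w j • f.V (f.embed (u j) ((j.modNat : ℕ) + 1)) +
        ∑ t, w' t • f.V (f.feature s t)) := by
  simp only [head, Fin.sum_univ_add, hw, hw', feature_append_left hf, feature_append_right hf]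

theorem le_natAdd_last (j : Fin (a + (l + 1))) : j ≤ Fin.natAdd a (Fin.last l) :=
  Fin.le_def.2 (by rw [Fin.val_natAdd, Fin.val_last]; omega)

variable [Fintype Tok] [Nonempty Tok]

theorem exists_limit_output (hf : f.IsPeriodic Δ) (hΔ : 0 < Δ) (ht : f.IsTranslationInvariant)
    (hτ : f.IsLocal τ) (hl : τ ≤ l) {p : ℕ} (hp : 0 < p) {γ : ℝ≥0∞} (hγ : γ ≠ 0)
    (hγf : γ ≤ f.logitMargin) {P : Tok → ℝ} (hP : ∑ z, P z = 1) {q : ℝ} (hq : 0 < q)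
    (hPq : ∀ z, q ≤ P z) (s : Fin (l + 1) → Tok) :
    ∃ F : Vec o, ∀ a : ℕ, 0 < a →
      (2 : ℝ) ^ ((p : ℝ≥0∞) / γ).toReal ≤ ((a * Δ + (l + 1) : ℕ) : ℝ) →
      ∑ u : Fin (a * Δ) → Tok, (∏ i, P (u i)) * ‖f.output p (Fin.append u s) - F‖ ≤
        f.normBound Δ * ((8 + 4 * (l + 1)) / (a * q) + 4 / √(a * q)) := by
  classical
  have hΔne : Nonempty (Fin Δ) := ⟨⟨0, hΔ⟩⟩
  obtain ⟨ρ, hρ, hV, -, hρL⟩ := hf.exists_radius hΔ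
  have hP0 : ∀ z, 0 ≤ P z := fun z => hq.le.trans (hPq z)
  set top : Tok → Fin Δ → ℝ := fun z r =>
    f.attn (s (Fin.last l)) (l + 1) z ((r : ℕ) + 1) with htop
  obtain ⟨⟨z₀, r₀⟩, hmax⟩ := Finite.exists_max fun t : Tok × Fin Δ => top t.1 t.2
  set M := top z₀ r₀ with hM
  have hmax' : ∀ z r, top z r ≤ M := fun z r => hmax (z, r)
  set c := f.maxLogit s (Fin.last l) with hc
  have hlogl : ∀ {a : ℕ} (u : Fin (a * Δ) → Tok) (j : Fin (a * Δ)),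
      f.logit (Fin.append u s) (Fin.natAdd (a * Δ) (Fin.last l)) (Fin.castAdd (l + 1) j) =
        top (u j) j.modNat := fun u j => logit_append_left hf hτ hl u s j
  have hlogr : ∀ {a : ℕ} (u : Fin (a * Δ) → Tok) (t : Fin (l + 1)),
      f.logit (Fin.append u s) (Fin.natAdd (a * Δ) (Fin.last l)) (Fin.natAdd (a * Δ) t) =
        f.logit s (Fin.last l) t := fun u t => logit_append_right hf ht u s _ t
  have hfeat : ∀ {a : ℕ} (u : Fin (a * Δ) → Tok),
      f.feature (Fin.append u s) (Fin.natAdd (a * Δ) (Fin.last l)) = f.feature s (Fin.last l) :=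
    fun u => feature_append_right hf u s (Fin.last l)
  have hlocal : ∀ t, f.logit s (Fin.last l) t ≤ c := fun t =>
    Finset.le_sup' (f.logit s (Fin.last l)) (Finset.mem_Iic.2 (Fin.le_last t))
  have hout : ∀ {a : ℕ} (u : Fin (a * Δ) → Tok), f.output p (Fin.append u s) =
      f.post (f.feature s (Fin.last l) + f.head p (Fin.append u s) (Fin.natAdd (a * Δ) (Fin.last l))) := by
    intro a u
    rw [← hfeat u]
    exact f.output_eq_post p (Fin.append u s) le_natAdd_last
  -- M is the best logit any prefix position can have, c the best in the suffix. If M < c, attention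
  -- stays in the suffix and the output equals its limit exactly.
  rcases lt_or_ge M c with hMc | hcM
  · refine ⟨f.post (f.feature s (Fin.last l) +
      (∑ t, if f.logit s (Fin.last l) t = c then (1 : ℝ) else 0)⁻¹ •
        ∑ t, (if f.logit s (Fin.last l) t = c then (1 : ℝ) else 0) • f.V (f.feature s t)),
      fun a ha hn => ?_⟩
    have hzero : ∀ u : Fin (a * Δ) → Tok, (∏ i, P (u i)) * ‖f.output p (Fin.append u s) -
        f.post (f.feature s (Fin.last l) +
        (∑ t, if f.logit s (Fin.last l) t = c then (1 : ℝ) else 0)⁻¹ •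
        ∑ t, (if f.logit s (Fin.last l) t = c then (1 : ℝ) else 0) •
          f.V (f.feature s t))‖ = 0 := by
      intro u
      have hmx : f.maxLogit (Fin.append u s) (Fin.natAdd (a * Δ) (Fin.last l)) = c := by
        obtain ⟨t, ht'⟩ := exists_logit_eq_maxLogit (f := f) s (Fin.last l)
        exact maxLogit_append u s le_natAdd_last
          (fun j => (hlogl u j).le.trans ((hmax' _ _).trans hMc.le))
          (fun t => (hlogr u t).le.trans (hlocal t)) ((hlogr u t).trans ht')
      rw [hout, head_append hf p u s _ (w := fun _ => 0)
        (w' := fun t => if f.logit s (Fin.last l) t = c then 1 else 0)]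
      · simp
      · intro j
        rw [weight_eq_ite ht hp hγ hγf _ hn (le_natAdd_last _), hmx, hlogl, if_neg]
        exact ((hmax' _ _).trans_lt hMc).ne
      · intro t
        rw [weight_eq_ite ht hp hγ hγf _ hn (le_natAdd_last _), hmx, hlogr]
    rw [Finset.sum_congr rfl fun u _ => hzero u, Finset.sum_const_zero]
    have := hf.normBound_nonneg hΔ
    positivity
  · set g : Tok → Fin Δ → ℝ := fun z r => if top z r = M then 1 else 0 with hg
    have hg0 : ∀ z r, 0 ≤ g z r := fun z r => by simp only [hg]; split_ifs <;> norm_num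
    set v : Tok → Fin Δ → Vec d := fun z r => f.V (f.embed z ((r : ℕ) + 1)) with hv
    have hvρ : ∀ z r, ‖v z r‖ ≤ ρ := fun z r => hV _ _
    set pG := ∑ r, ∑ z, P z * g z r with hpG
    have hqG : q ≤ pG := by
      calc q ≤ P z₀ * g z₀ r₀ := by simp only [hg, ← hM, if_true, mul_one]; exact hPq z₀
        _ ≤ ∑ z, P z * g z r₀ := Finset.single_le_sum
            (f := fun z => P z * g z r₀) (fun z _ => mul_nonneg (hP0 z) (hg0 z r₀))
              (Finset.mem_univ z₀)
        _ ≤ pG := Finset.single_le_sum (f := fun r => ∑ z, P z * g z r)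
            (fun r _ => Finset.sum_nonneg fun z _ => mul_nonneg (hP0 z) (hg0 z r))
              (Finset.mem_univ r₀)
    have hGpos : 0 < pG := hq.trans_le hqG
    -- The limit of the head: the mean value vector conditioned on a hit, with uniform residue. A
    -- bounded number of suffix positions tied with M does not affect it.
    set vbar := pG⁻¹ • ∑ r, ∑ z, (P z * g z r) • v z r with hvbar
    have hvbarρ : ‖vbar‖ ≤ ρ := by
      have := norm_inv_sum_smul_sum_le (Finset.univ : Finset (Fin Δ × Tok))
        (w := fun t => P t.2 * g t.2 t.1) (fun t _ => mul_nonneg (hP0 _) (hg0 _ _))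
        (v := fun t => v t.2 t.1) hρ (fun t _ => hvρ _ _)
      rwa [Fintype.sum_prod_type, Fintype.sum_prod_type] at this
    have hcenter : ∑ r, ∑ z, P z • g z r • (v z r - vbar) = 0 := by
      simp only [smul_sub, smul_smul, Finset.sum_sub_distrib, ← Finset.sum_smul]
      rw [← hpG, hvbar, smul_smul, mul_inv_cancel₀ hGpos.ne', one_smul, sub_self]
    refine ⟨f.post (f.feature s (Fin.last l) + vbar), fun a ha hn => ?_⟩
    have ha' : (0 : ℝ) < a := Nat.cast_pos.2 ha
    set μ := (a : ℝ) * pG with hμ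
    have hμ0 : 0 < μ := mul_pos ha' hGpos
    have hpt : ∀ u : Fin (a * Δ) → Tok, ‖f.output p (Fin.append u s) -
        f.post (f.feature s (Fin.last l) + vbar)‖ ≤
        f.postLip * (8 * ρ / μ ^ 2 * (∑ j, g (u j) j.modNat - μ) ^ 2 +
          2 / μ * (‖∑ j, g (u j) j.modNat • (v (u j) j.modNat - vbar)‖ +
            2 * Fintype.card (Fin (l + 1)) * ρ)) := by
      intro u
      rw [hout]
      refine (f.norm_post_sub_le _ _).trans (mul_le_mul_of_nonneg_left ?_ f.postLip_nonneg)
      rw [add_sub_add_left_eq_sub]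
      refine norm_head_sub_le (w := fun t => if f.logit s (Fin.last l) t = M then 1 else 0)
        (v' := fun t => f.V (f.feature s t)) 
        (fun t => by split_ifs <;> norm_num) (fun t => by split_ifs <;> norm_num)
        (fun j => v (u j) j.modNat) hμ0 (fun t => hV _ _) hvbarρ (norm_head_le hρ hV p _ _)
        (fun hpos => ?_)
      -- The maximal logit is known to be M only if some prefix position hits.
      obtain ⟨j₀, -, hj₀⟩ := Finset.exists_ne_zero_of_sum_ne_zero hpos.ne'
      have hj₀' : top (u j₀) j₀.modNat = M := by
        by_contra h
        exact hj₀ (if_neg h)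
      have hmx : f.maxLogit (Fin.append u s) (Fin.natAdd (a * Δ) (Fin.last l)) = M := by
        exact maxLogit_append u s le_natAdd_last (fun j => (hlogl u j).le.trans (hmax' _ _))
          (fun t => (hlogr u t).le.trans ((hlocal t).trans hcM)) ((hlogl u j₀).trans hj₀')
      refine head_append hf p u s _ (fun j => ?_) (fun t => ?_)
      · rw [weight_eq_ite ht hp hγ hγf _ hn (le_natAdd_last _), hmx, hlogl]
      · rw [weight_eq_ite ht hp hγ hγf _ hn (le_natAdd_last _), hmx, hlogr]
    have hprod0 : ∀ u : Fin (a * Δ) → Tok, 0 ≤ ∏ i, P (u i) := fun u =>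
      Finset.prod_nonneg fun i _ => hP0 _
    have hone := sum_prod_sequences_eq_one hP (a * Δ)
    have hvar := variance_count_le hP a fun z r => top z r = M
    have hdev := second_moment_deviation_le hP hP0 a (fun z r => top z r = M) v vbar
      (ρ := 2 * ρ) (fun z r => by linarith [norm_sub_le (v z r) vbar, hvρ z r]) hcenter
    have hdev' := sum_mul_norm_le_sqrt Finset.univ (fun u _ => hprod0 u) hone _ hdev
    change ∑ u : Fin (a * Δ) → Tok, (∏ i, P (u i)) * (∑ j, g (u j) j.modNat - μ) ^ 2 ≤ μ at hvar
    change ∑ u : Fin (a * Δ) → Tok, (∏ i, P (u i)) *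
      ‖∑ j, g (u j) j.modNat • (v (u j) j.modNat - vbar)‖ ≤ √((2 * ρ) ^ 2 * μ) at hdev'
    rw [Real.sqrt_mul (by positivity), Real.sqrt_sq (by positivity)] at hdev'
    have hsum : ∑ u : Fin (a * Δ) → Tok, (∏ i, P (u i)) * ‖f.output p (Fin.append u s) -
        f.post (f.feature s (Fin.last l) + vbar)‖ ≤
        f.postLip * (8 * ρ / μ ^ 2 * (∑ u : Fin (a * Δ) → Tok,
            (∏ i, P (u i)) * (∑ j, g (u j) j.modNat - μ) ^ 2) +
          2 / μ * (∑ u : Fin (a * Δ) → Tok, (∏ i, P (u i)) *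
              ‖∑ j, g (u j) j.modNat • (v (u j) j.modNat - vbar)‖ +
            2 * Fintype.card (Fin (l + 1)) * ρ)) := by
      refine (Finset.sum_le_sum fun u _ =>
        mul_le_mul_of_nonneg_left (hpt u) (hprod0 u)).trans (le_of_eq ?_)
      exact sum_mul_affine _ hone _ _ _ _ _ _
    refine hsum.trans ?_
    have hsμ : 0 < √μ := Real.sqrt_pos.2 hμ0
    have hfin : f.postLip * (8 * ρ / μ ^ 2 * (∑ u : Fin (a * Δ) → Tok,
            (∏ i, P (u i)) * (∑ j, g (u j) j.modNat - μ) ^ 2) +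
          2 / μ * (∑ u : Fin (a * Δ) → Tok, (∏ i, P (u i)) *
              ‖∑ j, g (u j) j.modNat • (v (u j) j.modNat - vbar)‖ +
            2 * Fintype.card (Fin (l + 1)) * ρ)) ≤
        f.postLip * (8 * ρ / μ ^ 2 * μ +
          2 / μ * (2 * ρ * √μ + 2 * Fintype.card (Fin (l + 1)) * ρ)) := by
      have := f.postLip_nonneg
      gcongr
    have hval : f.postLip * (8 * ρ / μ ^ 2 * μ +
          2 / μ * (2 * ρ * √μ + 2 * Fintype.card (Fin (l + 1)) * ρ)) =
        (f.postLip * ρ) * ((8 + 4 * (l + 1)) / μ + 4 / √μ) := by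
      rw [Fintype.card_fin]
      have hsq : √μ * √μ = μ := Real.mul_self_sqrt hμ0.le
      have h4 : 4 / √μ = 4 * √μ / μ := by
        rw [div_eq_div_iff hsμ.ne' hμ0.ne', mul_assoc, hsq]
      rw [h4]
      push_cast
      field_simp
      ring
    rw [hval] at hfin
    refine hfin.trans ?_
    have hμq : (a : ℝ) * q ≤ μ := mul_le_mul_of_nonneg_left hqG ha'.le
    have haq : 0 < (a : ℝ) * q := mul_pos ha' hq
    refine mul_le_mul hρL ?_ (by positivity) (hf.normBound_nonneg hΔ)
    gcongr

end LimitTransformer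

/-! ### Transfer of the error between lengths -/

section Comparison

open LimitTransformer MeasureTheory

variable {Tok : Type u} [Fintype Tok] [Nonempty Tok] {d k m d' k' m' o Δ τ : ℕ}
  {f : LimitTransformer Tok d k m o} {g : LimitTransformer Tok d' k' m' o}

theorem errorGiven_le_add_normBound (hf : f.IsPeriodic Δ) (hg : g.IsPeriodic Δ) (hΔ : 0 < Δ)
    (p : ℕ) {N T : ℕ} (hN : 0 < N) (hT : 0 < T) {P : Tok → ℝ} (hP0 : ∀ s, 0 ≤ P s)
    (hP : ∑ s, P s = 1) :
    errorGiven f g p T P ≤ errorGiven f g p N P + 4 * (f.normBound Δ + g.normBound Δ) := by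
  have hprod : ∀ {n : ℕ} (x : Fin n → Tok), 0 ≤ ∏ i, P (x i) := fun x =>
    Finset.prod_nonneg fun i _ => hP0 _
  have h : ∀ (x : Fin T → Tok) (y : Fin N → Tok), ‖f.output p x - g.output p x‖ ≤
      ‖f.output p y - g.output p y‖ + 4 * (f.normBound Δ + g.normBound Δ) := by
    intro x y
    have h1 := hf.norm_output_sub_output_le hΔ p hT hN x y
    have h2 := hg.norm_output_sub_output_le hΔ p hN hT y x
    have h3 : f.output p x - g.output p x = (f.output p x - f.output p y) +
      (f.output p y - g.output p y) + (g.output p y - g.output p x) := by abel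
    rw [h3]
    linarith [norm_add₃_le (a := f.output p x - f.output p y) (b := f.output p y - g.output p y)
      (c := g.output p y - g.output p x)]
  have h' : ∀ x : Fin T → Tok, ‖f.output p x - g.output p x‖ ≤
      errorGiven f g p N P + 4 * (f.normBound Δ + g.normBound Δ) := by
    intro x
    calc ‖f.output p x - g.output p x‖
        = ∑ y : Fin N → Tok, (∏ i, P (y i)) * ‖f.output p x - g.output p x‖ := by
          rw [← Finset.sum_mul, sum_prod_sequences_eq_one hP, one_mul]
      _ ≤ ∑ y : Fin N → Tok, (∏ i, P (y i)) * (‖f.output p y - g.output p y‖ +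
            4 * (f.normBound Δ + g.normBound Δ)) :=
          Finset.sum_le_sum fun y _ => mul_le_mul_of_nonneg_left (h x y) (hprod y)
      _ = _ := by
          simp only [mul_add _ ‖_‖, Finset.sum_add_distrib, ← Finset.sum_mul]
          rw [sum_prod_sequences_eq_one hP, one_mul, errorGiven]
  calc errorGiven f g p T P ≤ ∑ x : Fin T → Tok, (∏ i, P (x i)) *
        (errorGiven f g p N P + 4 * (f.normBound Δ + g.normBound Δ)) :=
        Finset.sum_le_sum fun x _ => mul_le_mul_of_nonneg_left (h' x) (hprod x)
    _ = _ := by rw [← Finset.sum_mul, sum_prod_sequences_eq_one hP, one_mul]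

/-- Both lengths share the suffix, hence the limits F and G. The triangle inequality through ‖F - G‖
uses four concentration bounds: f and g, at each of the two lengths. -/
theorem errorGiven_le_add_of_le_coord (hf : f.IsPeriodic Δ) (hft : f.IsTranslationInvariant)
    (hfτ : f.IsLocal τ) (hg : g.IsPeriodic Δ) (hgt : g.IsTranslationInvariant)
    (hgτ : g.IsLocal τ) (hΔ : 0 < Δ) {p : ℕ} (hp : 0 < p) {l : ℕ} (hl : τ ≤ l) {a b : ℕ}
    (ha : 0 < a) (hab : a ≤ b)
    (hn : (2 : ℝ) ^ ((p : ℝ≥0∞) / min f.logitMargin g.logitMargin).toReal ≤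
      ((a * Δ + (l + 1) : ℕ) : ℝ))
    {P : Tok → ℝ} (hP : ∑ s, P s = 1) {q : ℝ} (hq : 0 < q) (hPq : ∀ s, q ≤ P s) :
    errorGiven f g p (b * Δ + (l + 1)) P ≤ errorGiven f g p (a * Δ + (l + 1)) P +
      2 * (f.normBound Δ + g.normBound Δ) * ((8 + 4 * (l + 1)) / (a * q) + 4 / √(a * q)) := by
  set γ := min f.logitMargin g.logitMargin with hγdef
  have hγ : γ ≠ 0 :=
    (lt_min (pos_iff_ne_zero.2 (logitMargin_pos hf hΔ hfτ))
      (pos_iff_ne_zero.2 (logitMargin_pos hg hΔ hgτ))).ne'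
  have hP0 : ∀ s, 0 ≤ P s := fun s => hq.le.trans (hPq s)
  have hprod : ∀ {n : ℕ} (x : Fin n → Tok), 0 ≤ ∏ i, P (x i) := fun x =>
    Finset.prod_nonneg fun i _ => hP0 _
  have ha' : (0 : ℝ) < a := Nat.cast_pos.2 ha
  have hab' : (a : ℝ) ≤ b := Nat.cast_le.2 hab
  set η := (8 + 4 * ((l : ℝ) + 1)) / (a * q) + 4 / √(a * q) with hη
  have hηb : (8 + 4 * ((l : ℝ) + 1)) / (b * q) + 4 / √(b * q) ≤ η := by
    have : 0 < (a : ℝ) * q := mul_pos ha' hq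
    have : 0 < √((a : ℝ) * q) := Real.sqrt_pos.2 this
    rw [hη]
    gcongr
  have hLf := hf.normBound_nonneg hΔ
  have hLg := hg.normBound_nonneg hΔ
  have hnb : (2 : ℝ) ^ ((p : ℝ≥0∞) / γ).toReal ≤ ((b * Δ + (l + 1) : ℕ) : ℝ) := by
    refine hn.trans (Nat.cast_le.2 ?_)
    gcongr
  rw [errorGiven, errorGiven, sum_append_sequences (a := b * Δ) (l := l + 1),
    sum_append_sequences (a := a * Δ) (l := l + 1)]
  have key : ∀ s : Fin (l + 1) → Tok,
      ∑ u : Fin (b * Δ) → Tok, (∏ i, P (u i)) *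
        ‖f.output p (Fin.append u s) - g.output p (Fin.append u s)‖ ≤
      ∑ u : Fin (a * Δ) → Tok, (∏ i, P (u i)) *
        ‖f.output p (Fin.append u s) - g.output p (Fin.append u s)‖ +
      2 * (f.normBound Δ + g.normBound Δ) * η := by
    intro s
    obtain ⟨F, hF⟩ := exists_limit_output hf hΔ hft hfτ hl hp hγ (min_le_left _ _) hP hq hPq s
    obtain ⟨G, hG⟩ := exists_limit_output hg hΔ hgt hgτ hl hp hγ (min_le_right _ _) hP hq hPq s
    have hFa := hF a ha hn
    have hGa := hG a ha hn
    have hFb := (hF b (ha.trans_le hab) hnb).trans (mul_le_mul_of_nonneg_left hηb hLf)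
    have hGb := (hG b (ha.trans_le hab) hnb).trans (mul_le_mul_of_nonneg_left hηb hLg)
    have hb : ∑ u : Fin (b * Δ) → Tok, (∏ i, P (u i)) *
        ‖f.output p (Fin.append u s) - g.output p (Fin.append u s)‖ ≤
        ∑ u : Fin (b * Δ) → Tok, (∏ i, P (u i)) * ‖f.output p (Fin.append u s) - F‖ +
        ∑ u : Fin (b * Δ) → Tok, (∏ i, P (u i)) * ‖g.output p (Fin.append u s) - G‖ +
        ‖F - G‖ := by
      have h1 : ‖F - G‖ = ∑ u : Fin (b * Δ) → Tok, (∏ i, P (u i)) * ‖F - G‖ := by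
        rw [← Finset.sum_mul, sum_prod_sequences_eq_one hP, one_mul]
      rw [h1, ← Finset.sum_add_distrib, ← Finset.sum_add_distrib]
      refine Finset.sum_le_sum fun u _ => ?_
      rw [← mul_add, ← mul_add]
      refine mul_le_mul_of_nonneg_left ?_ (hprod u)
      rw [norm_sub_rev (g.output p _) G]
      have h2 : f.output p (Fin.append u s) - g.output p (Fin.append u s) =
        (f.output p (Fin.append u s) - F) + (G - g.output p (Fin.append u s)) + (F - G) := by abel
      rw [h2]
      exact norm_add₃_le
    have ha2 : ‖F - G‖ ≤ ∑ u : Fin (a * Δ) → Tok, (∏ i, P (u i)) *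
          ‖f.output p (Fin.append u s) - g.output p (Fin.append u s)‖ +
        ∑ u : Fin (a * Δ) → Tok, (∏ i, P (u i)) * ‖f.output p (Fin.append u s) - F‖ +
        ∑ u : Fin (a * Δ) → Tok, (∏ i, P (u i)) * ‖g.output p (Fin.append u s) - G‖ := by
      have h1 : ‖F - G‖ = ∑ u : Fin (a * Δ) → Tok, (∏ i, P (u i)) * ‖F - G‖ := by
        rw [← Finset.sum_mul, sum_prod_sequences_eq_one hP, one_mul]
      rw [h1, ← Finset.sum_add_distrib, ← Finset.sum_add_distrib]
      refine Finset.sum_le_sum fun u _ => ?_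
      rw [← mul_add, ← mul_add]
      refine mul_le_mul_of_nonneg_left ?_ (hprod u)
      rw [norm_sub_rev (f.output p _) F]
      have h2 : F - G = (f.output p (Fin.append u s) - g.output p (Fin.append u s)) +
        (F - f.output p (Fin.append u s)) + (g.output p (Fin.append u s) - G) := by abel
      conv_lhs => rw [h2]
      exact norm_add₃_le
    linarith
  calc _ ≤ ∑ s : Fin (l + 1) → Tok, (∏ i, P (s i)) * (∑ u : Fin (a * Δ) → Tok,
        (∏ i, P (u i)) * ‖f.output p (Fin.append u s) - g.output p (Fin.append u s)‖ +
          2 * (f.normBound Δ + g.normBound Δ) * η) :=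
        Finset.sum_le_sum fun s _ => mul_le_mul_of_nonneg_left (key s) (hprod s)
    _ = _ := by
        simp only [mul_add (∏ i, P _), Finset.sum_add_distrib, ← Finset.sum_mul]
        rw [sum_prod_sequences_eq_one hP, one_mul]

variable {α : Tok → ℝ}

theorem avgError_le_add_normBound (hα : ∀ s, 0 < α s) (hf : f.IsPeriodic Δ) (hg : g.IsPeriodic Δ)
    (hΔ : 0 < Δ) (p : ℕ) {N T : ℕ} (hN : 0 < N) (hT : 0 < T) :
    avgError f g α p T ≤ avgError f g α p N + 4 * (f.normBound Δ + g.normBound Δ) := by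
  have := isProbabilityMeasure_dirichletMeasure hα
  have h := integral_mono_ae (integrable_errorGiven hα f g p T)
    ((integrable_errorGiven hα f g p N).add
      (integrable_const (4 * (f.normBound Δ + g.normBound Δ)))) (by
        filter_upwards [ae_mem_simplex_dirichletMeasure hα] with P hP
        exact errorGiven_le_add_normBound hf hg hΔ p hN hT hP.1 hP.2)
  rw [integral_add' (integrable_errorGiven hα f g p N) (integrable_const _)] at h
  simpa [avgError] using h

theorem avgError_le_add (hα : ∀ s, 0 < α s) (hf : f.IsPeriodic Δ)
    (hft : f.IsTranslationInvariant) (hfτ : f.IsLocal τ) (hg : g.IsPeriodic Δ)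
    (hgt : g.IsTranslationInvariant) (hgτ : g.IsLocal τ) (hΔ : 0 < Δ) {p : ℕ} (hp : 0 < p)
    {l : ℕ} (hl : τ ≤ l) {a b : ℕ} (ha : 0 < a) (hab : a ≤ b)
    (hn : (2 : ℝ) ^ ((p : ℝ≥0∞) / min f.logitMargin g.logitMargin).toReal ≤
      ((a * Δ + (l + 1) : ℕ) : ℝ)) {q : ℝ} (hq : 0 < q) (hq1 : q ≤ 1) :
    avgError f g α p (b * Δ + (l + 1)) ≤ avgError f g α p (a * Δ + (l + 1)) +
      4 * (f.normBound Δ + g.normBound Δ) *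
        (Fintype.card Tok * ((2 : ℝ) ^ (∑ t, α t) * q ^ (⨅ s, α s))) +
      2 * (f.normBound Δ + g.normBound Δ) * ((8 + 4 * (l + 1)) / (a * q) + 4 / √(a * q)) := by
  have := isProbabilityMeasure_dirichletMeasure hα
  have hLf := hf.normBound_nonneg hΔ
  have hLg := hg.normBound_nonneg hΔ
  set L := f.normBound Δ + g.normBound Δ with hL
  have hL0 : 0 ≤ L := add_nonneg hLf hLg
  set η := (8 + 4 * ((l : ℝ) + 1)) / (a * q) + 4 / √(a * q) with hη
  have hη0 : 0 ≤ η := by positivity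
  -- Off B the concentration bound applies; on B only the oscillation bound 4L does.
  set B : Set (Tok → ℝ) := {P | ∃ s, P s < q} with hB
  have hBm : MeasurableSet B := by
    have : B = ⋃ s, {P | P s < q} := by ext; simp [hB]
    rw [this]
    exact MeasurableSet.iUnion fun s => measurableSet_lt (measurable_pi_apply s) measurable_const
  have hi1 := integrable_errorGiven hα f g p (a * Δ + (l + 1))
  have hi2 : Integrable (B.indicator fun _ => 4 * L) (dirichletMeasure α) :=
    (integrable_const _).indicator hBm
  have h := integral_mono_ae (integrable_errorGiven hα f g p (b * Δ + (l + 1)))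
    ((hi1.add hi2).add (integrable_const (2 * L * η))) (by
      filter_upwards [ae_mem_simplex_dirichletMeasure hα] with P hP
      change _ ≤ errorGiven f g p (a * Δ + (l + 1)) P + B.indicator (fun _ => 4 * L) P + 2 * L * η
      have h0 : 0 ≤ 2 * L * η := by positivity
      by_cases hPB : P ∈ B
      · rw [Set.indicator_of_mem hPB]
        have := errorGiven_le_add_normBound hf hg hΔ p (N := a * Δ + (l + 1))
          (T := b * Δ + (l + 1)) (by omega) (by omega) hP.1 hP.2
        linarith
      · rw [Set.indicator_of_notMem hPB, add_zero]
        refine errorGiven_le_add_of_le_coord hf hft hfτ hg hgt hgτ hΔ hp hl ha hab hn hP.2 hq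
          fun s => ?_
        by_contra hs
        exact hPB ⟨s, not_le.1 hs⟩)
  rw [integral_add' (hi1.add hi2) (integrable_const _), integral_add' hi1 hi2,
    integral_indicator_const _ hBm] at h
  simp only [integral_const, probReal_univ, smul_eq_mul, one_mul] at h
  have hμ := mul_le_mul_of_nonneg_left (dirichletMeasure_exists_lt_le hα hq hq1)
    (by positivity : 0 ≤ 4 * L)
  rw [avgError, avgError]
  rw [mul_comm] at hμ
  linarith

end Comparison

/-! ### Numerical estimates for the length bound -/

section LengthBound

theorem one_le_lengthBound (p : ℕ) (γ : ℝ≥0∞) (S Δ : ℕ) (A a₀ L ε : ℝ) :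
    1 ≤ lengthBound p γ S Δ A a₀ L ε :=
  le_max_of_le_left (Real.one_le_rpow one_le_two ENNReal.toReal_nonneg)

theorem rpow_two_div_self_le {a : ℝ} (ha : 0 < a) : a ^ (2 / a) ≤ 8 := by
  have h1 : Real.log a * (2 / a) ≤ 2 := by
    have := Real.log_le_sub_one_of_pos ha
    rw [mul_div_assoc', div_le_iff₀ ha]
    linarith
  have h2 : Real.exp 2 ≤ 8 := by
    have h3 : Real.exp 2 = Real.exp 1 ^ 2 := by rw [← Real.exp_nat_mul]; norm_num
    rw [h3]
    nlinarith [Real.exp_one_lt_d9, Real.exp_pos 1]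
  rw [Real.rpow_def_of_pos ha]
  exact (Real.exp_le_exp.2 h1).trans h2

theorem exists_threshold {S Δ : ℕ} (hS : 0 < S) (hΔ : 0 < Δ) {A a₀ L ε : ℝ} (hA : 0 ≤ A)
    (ha₀ : 0 < a₀) (hε : 0 < ε) (hε1 : ε ≤ 1 / 36) (hL : √ε ≤ L) (p : ℕ) (γ : ℝ≥0∞) :
    ∃ q : ℝ, 0 < q ∧ q ≤ 1 ∧ L * (S * ((2 : ℝ) ^ A * q ^ a₀)) = ε ∧
      (L / ε) ^ 2 * (Δ : ℝ) ^ 5 ≤ 8 * (q * lengthBound p γ S Δ A a₀ L ε) := by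
  have hS1 : (1 : ℝ) ≤ S := by exact_mod_cast hS
  have hΔ1 : (1 : ℝ) ≤ Δ := by exact_mod_cast hΔ
  have hsε : 0 < √ε := Real.sqrt_pos.2 hε
  have hsq : √ε * √ε = ε := Real.mul_self_sqrt hε.le
  have hs6 : √ε ≤ 1 / 6 := Real.sqrt_le_iff.2 ⟨by norm_num, by linarith⟩
  have hL0 : 0 < L := hsε.trans_le hL
  have hLε : 6 ≤ L / ε := by
    rw [le_div_iff₀ hε]; nlinarith
  set x := L * S / ε with hx
  have hx1 : 1 ≤ x := by
    rw [hx, mul_div_right_comm]; nlinarith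
  have hx0 : 0 < x := by linarith
  set y := x ^ (1 / a₀) with hy
  set z := (2 : ℝ) ^ (A / a₀) with hz
  have hy1 : 1 ≤ y := Real.one_le_rpow hx1 (by positivity)
  have hz1 : 1 ≤ z := Real.one_le_rpow one_le_two (by positivity)
  have hyz : 1 ≤ y * z := one_le_mul_of_one_le_of_one_le hy1 hz1
  have hy0 : 0 < y := by linarith
  have hz0 : 0 < z := by linarith
  -- This q solves L S 2^A q^a₀ = ε. The length bound contains y² z⁴ where only 1/q = yz is needed;
  -- the factor a₀^(2/a₀) in its denominator is at most 8, and its logarithm is at least 1 because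
  -- L/ε ≥ 6 > e.
  refine ⟨(y * z)⁻¹, by positivity, inv_le_one_of_one_le₀ hyz, ?_, ?_⟩
  · rw [Real.inv_rpow (by positivity), Real.mul_rpow hy0.le hz0.le, hy, hz,
      ← Real.rpow_mul hx0.le, ← Real.rpow_mul two_pos.le, one_div_mul_cancel ha₀.ne',
      div_mul_cancel₀ _ ha₀.ne', Real.rpow_one, hx]
    have : (2 : ℝ) ^ A ≠ 0 := (Real.rpow_pos_of_pos two_pos A).ne'
    have : (S : ℝ) ≠ 0 := by positivity
    field_simp
  · have hlog : 1 ≤ Real.log (S * Δ * L / ε) := by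
      rw [Real.le_log_iff_exp_le (by positivity)]
      have h1 : L / ε ≤ S * Δ * L / ε := by
        have : (1 : ℝ) ≤ S * Δ := one_le_mul_of_one_le_of_one_le hS1 hΔ1
        rw [mul_div_assoc]
        exact le_mul_of_one_le_left (by linarith) this
      linarith [Real.exp_one_lt_d9]
    have hterm : (16 : ℝ) ^ (A / a₀) * L ^ (2 + 2 / a₀) * (S : ℝ) ^ (4 + 2 / a₀) * (Δ : ℝ) ^ 5 /
        (a₀ ^ (2 / a₀) * ε ^ (2 + 2 / a₀)) =
        z ^ 4 * y ^ 2 * (L / ε) ^ 2 * (S : ℝ) ^ 4 * (Δ : ℝ) ^ 5 / a₀ ^ (2 / a₀) := by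
      have e1 : (16 : ℝ) ^ (A / a₀) = z ^ 4 := by
        rw [hz, ← Real.rpow_natCast, ← Real.rpow_mul two_pos.le, mul_comm, Real.rpow_mul two_pos.le]
        norm_num
      have e2 : y ^ 2 = L ^ (2 / a₀) * (S : ℝ) ^ (2 / a₀) / ε ^ (2 / a₀) := by
        rw [← Real.mul_rpow hL0.le (by positivity), ← Real.div_rpow (by positivity) hε.le, hy, ← hx,
          ← Real.rpow_natCast, ← Real.rpow_mul hx0.le]
        congr 1
        push_cast
        ring
      have e3 : L ^ (2 + 2 / a₀) = L ^ 2 * L ^ (2 / a₀) := by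
        rw [Real.rpow_add hL0, Real.rpow_ofNat]
      have e4 : ε ^ (2 + 2 / a₀) = ε ^ 2 * ε ^ (2 / a₀) := by
        rw [Real.rpow_add hε, Real.rpow_ofNat]
      have e5 : (S : ℝ) ^ (4 + 2 / a₀) = (S : ℝ) ^ 4 * (S : ℝ) ^ (2 / a₀) := by
        rw [Real.rpow_add (by positivity), Real.rpow_ofNat]
      rw [e1, e2, e3, e4, e5]
      have : a₀ ^ (2 / a₀) ≠ 0 := (Real.rpow_pos_of_pos ha₀ _).ne'
      have : ε ^ (2 / a₀) ≠ 0 := (Real.rpow_pos_of_pos hε _).ne'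
      field_simp
    have hw0 : 0 < a₀ ^ (2 / a₀) := Real.rpow_pos_of_pos ha₀ _
    have h1 : (L / ε) ^ 2 * (Δ : ℝ) ^ 5 * (y * z) ≤
        z ^ 4 * y ^ 2 * (L / ε) ^ 2 * (S : ℝ) ^ 4 * (Δ : ℝ) ^ 5 := by
      have hz4 : z ≤ z ^ 4 := le_self_pow₀ hz1 (by norm_num)
      have hy2 : y ≤ y ^ 2 := le_self_pow₀ hy1 (by norm_num)
      have hS4 : 1 ≤ (S : ℝ) ^ 4 := one_le_pow₀ hS1
      calc (L / ε) ^ 2 * (Δ : ℝ) ^ 5 * (y * z) = z * y * (L / ε) ^ 2 * 1 * (Δ : ℝ) ^ 5 := by ring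
        _ ≤ _ := by gcongr
    have h2 : (L / ε) ^ 2 * (Δ : ℝ) ^ 5 * (y * z) ≤ 8 * lengthBound p γ S Δ A a₀ L ε := by
      set X := z ^ 4 * y ^ 2 * (L / ε) ^ 2 * (S : ℝ) ^ 4 * (Δ : ℝ) ^ 5 with hX
      have hX0 : 0 ≤ X := by positivity
      calc _ ≤ X := h1
        _ ≤ 8 * (X / a₀ ^ (2 / a₀)) := by
            rw [← mul_div_assoc, le_div_iff₀ hw0]
            nlinarith [rpow_two_div_self_le ha₀]
        _ ≤ 8 * (X / a₀ ^ (2 / a₀) * Real.log (S * Δ * L / ε)) := by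
            gcongr
            exact le_mul_of_one_le_right (by positivity) hlog
        _ ≤ 8 * lengthBound p γ S Δ A a₀ L ε := by
            rw [lengthBound, hterm]
            gcongr
            exact le_max_right _ _
    rw [mul_left_comm, inv_mul_eq_div, le_div_iff₀ (by positivity)]
    exact h2

theorem isBigO_lengthBound {S Δ : ℕ} (hS : 0 < S) (hΔ : 0 < Δ) {A a₀ L : ℝ} (ha₀ : 0 < a₀)
    (hL : 0 ≤ L) (p : ℕ) (γ : ℝ≥0∞) :
    (fun ε : ℝ => lengthBound p γ S Δ A a₀ L ε) =O[nhdsWithin 0 (Set.Ioi 0)]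
      (fun ε : ℝ => ε ^ (-(2 + 2 / a₀)) * Real.log (1 / ε)) := by
  set e := 2 + 2 / a₀ with he
  have he0 : 0 < e := by positivity
  set D := (16 : ℝ) ^ (A / a₀) * L ^ e * (S : ℝ) ^ (4 + 2 / a₀) * (Δ : ℝ) ^ 5 / a₀ ^ (2 / a₀)
    with hD
  have hD0 : 0 ≤ D := by positivity
  set c := (2 : ℝ) ^ ((p : ℝ≥0∞) / γ).toReal with hc
  have hc0 : 0 ≤ c := by positivity
  refine Asymptotics.IsBigO.of_bound (c + D * (|Real.log (S * Δ * L)| + 1)) ?_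
  have hsmall : Set.Ioo (0 : ℝ) (Real.exp (-1)) ∈ nhdsWithin (0 : ℝ) (Set.Ioi 0) :=
    Ioo_mem_nhdsGT (Real.exp_pos _)
  filter_upwards [hsmall] with ε hε
  obtain ⟨hε0, hεe⟩ := hε
  have hlog1 : 1 ≤ Real.log (1 / ε) := by
    have := Real.log_lt_log hε0 hεe
    rw [Real.log_exp] at this
    rw [one_div, Real.log_inv]
    linarith
  have hpow : 1 ≤ ε ^ (-e) := by
    refine Real.one_le_rpow_of_pos_of_le_one_of_nonpos hε0 ?_ (by linarith)
    exact hεe.le.trans (Real.exp_le_one_iff.2 (by norm_num))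
  rw [Real.norm_of_nonneg (zero_le_one.trans (one_le_lengthBound ..)),
    Real.norm_of_nonneg (mul_nonneg (by linarith) (by linarith))]
  have hprod : 1 ≤ ε ^ (-e) * Real.log (1 / ε) := one_le_mul_of_one_le_of_one_le hpow hlog1
  have h2 : (16 : ℝ) ^ (A / a₀) * L ^ e * (S : ℝ) ^ (4 + 2 / a₀) * (Δ : ℝ) ^ 5 /
      (a₀ ^ (2 / a₀) * ε ^ e) * Real.log (S * Δ * L / ε) ≤
      D * (|Real.log (S * Δ * L)| + 1) * (ε ^ (-e) * Real.log (1 / ε)) := by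
    have h3 : (16 : ℝ) ^ (A / a₀) * L ^ e * (S : ℝ) ^ (4 + 2 / a₀) * (Δ : ℝ) ^ 5 /
      (a₀ ^ (2 / a₀) * ε ^ e) = D * ε ^ (-e) := by
      rw [hD, Real.rpow_neg hε0.le, div_mul_eq_div_div, div_eq_mul_inv _ (ε ^ e)]
    rw [h3]
    -- For L = 0 the power of L makes the whole term vanish, whatever value the logarithm takes.
    rcases hL.eq_or_lt with h0 | h0
    · have : D = 0 := by rw [hD, ← h0, Real.zero_rpow he0.ne']; simp
      simp [this]
    · have hlogle : Real.log (S * Δ * L / ε) ≤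
          (|Real.log (S * Δ * L)| + 1) * Real.log (1 / ε) := by
        rw [div_eq_mul_one_div, Real.log_mul (by positivity) (by positivity)]
        nlinarith [le_abs_self (Real.log (S * Δ * L)), abs_nonneg (Real.log (S * Δ * L))]
      calc _ ≤ D * ε ^ (-e) * ((|Real.log (S * Δ * L)| + 1) * Real.log (1 / ε)) := by gcongr
        _ = _ := by ring
  rw [lengthBound, add_mul]
  have h4 : c ≤ c * (ε ^ (-e) * Real.log (1 / ε)) := le_mul_of_one_le_right hc0 hprod
  have h5 : 0 ≤ D * (|Real.log (S * Δ * L)| + 1) * (ε ^ (-e) * Real.log (1 / ε)) := by positivity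
  have h6 : 0 ≤ c * (ε ^ (-e) * Real.log (1 / ε)) := by positivity
  exact max_le (by linarith) (by linarith)

end LengthBound

theorem sqrt_le_inv_of_le {τ : ℕ} {ε : ℝ} (hε : ε ≤ 1 / (9 * ((τ : ℝ) + 2) ^ 2)) :
    √ε * (τ + 2) ≤ 1 / 3 := by
  have h : √ε ≤ 1 / (3 * ((τ : ℝ) + 2)) := by
    refine Real.sqrt_le_iff.2 ⟨by positivity, hε.trans (le_of_eq ?_)⟩
    rw [div_pow, mul_pow]
    norm_num
  calc √ε * (τ + 2) ≤ 1 / (3 * ((τ : ℝ) + 2)) * (τ + 2) := by gcongr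
    _ = 1 / 3 := by field_simp

theorem error_term_le {τ l Δ : ℕ} (hΔ : 0 < Δ) (hl : l + 1 ≤ τ + Δ) {L ε M : ℝ} (hε : 0 < ε)
    (hετ : √ε * (τ + 2) ≤ 1 / 3) (hL : √ε ≤ L) (hM : (L / ε) ^ 2 * (Δ : ℝ) ^ 4 ≤ 8 * M) :
    2 * L * ((8 + 4 * ((l : ℝ) + 1)) / M + 4 / √M) ≤ 72 * ε := by
  have hΔ1 : (1 : ℝ) ≤ Δ := by exact_mod_cast hΔ
  have hl' : (l : ℝ) + 1 ≤ τ + Δ := by exact_mod_cast hl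
  have hs : 0 < √ε := Real.sqrt_pos.2 hε
  have hsq : √ε * √ε = ε := Real.mul_self_sqrt hε.le
  have hL0 : 0 < L := hs.trans_le hL
  have hτ0 : (0 : ℝ) ≤ τ := Nat.cast_nonneg τ
  have hLε : 0 < L / ε := by positivity
  have hM1 : (L / ε) ^ 2 * Δ ≤ 8 * M :=
    (mul_le_mul_of_nonneg_left (le_self_pow₀ hΔ1 (by norm_num)) (by positivity)).trans hM
  have hM0 : 0 < M := by
    have : 0 < (L / ε) ^ 2 * Δ := by positivity
    linarith
  have hnum : 8 + 4 * ((l : ℝ) + 1) ≤ 8 * (τ + 2) * Δ := by nlinarith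
  have hLs : L / ε * √ε ≥ 1 := by
    rw [ge_iff_le, div_mul_eq_mul_div, le_div_iff₀ hε]
    nlinarith
  have h1 : L * ((8 + 4 * ((l : ℝ) + 1)) / M) ≤ 22 * ε := by
    rw [mul_div_assoc', div_le_iff₀ hM0]
    -- The suffix length is absorbed here: ε is small in terms of τ, while L/ε ≥ 1/√ε.
    have h3 : (τ : ℝ) + 2 ≤ L / ε / 3 := by
      nlinarith [mul_le_mul_of_nonneg_left hετ hLε.le,
        mul_le_mul_of_nonneg_right hLs (by positivity : (0 : ℝ) ≤ τ + 2)]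
    calc L * (8 + 4 * ((l : ℝ) + 1)) ≤ L * (8 * (L / ε / 3) * Δ) := by
          refine mul_le_mul_of_nonneg_left (hnum.trans ?_) hL0.le
          gcongr
      _ = 8 / 3 * ε * ((L / ε) ^ 2 * Δ) := by field_simp
      _ ≤ 8 / 3 * ε * (8 * M) := by gcongr
      _ ≤ 22 * ε * M := by nlinarith [mul_pos hε hM0]
  have h2 : L * (4 / √M) ≤ 12 * ε := by
    have h4 : L / ε ≤ 3 * √M := by
      have h5 : (L / ε) ^ 2 ≤ 8 * M :=
        (le_mul_of_one_le_right (by positivity) hΔ1).trans hM1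
      have h6 := Real.sq_sqrt hM0.le
      refine le_of_sq_le_sq ?_ (by positivity)
      nlinarith
    rw [mul_div_assoc', div_le_iff₀ (Real.sqrt_pos.2 hM0)]
    rw [div_le_iff₀ hε] at h4
    linarith
  linarith

/-- The training length used when the transformers are not trivially close. -/
noncomputable def trainingLength (τ Δ : ℕ) (X : ℝ) : ℕ := ⌈X / Δ⌉₊ * Δ + τ + Δ

theorem trainingLength_le {τ Δ : ℕ} (hΔ : 0 < Δ) {X : ℝ} (hX : 0 ≤ X) :
    (trainingLength τ Δ X : ℝ) ≤ X + τ + 2 * Δ := by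
  have hΔ' : (0 : ℝ) < Δ := Nat.cast_pos.2 hΔ
  have h := mul_le_mul_of_nonneg_right (Nat.ceil_lt_add_one (div_nonneg hX hΔ'.le)).le hΔ'.le
  rw [add_mul, div_mul_cancel₀ _ hΔ'.ne', one_mul] at h
  rw [trainingLength]
  push_cast
  linarith

/-! ### Choice of the training length and conclusion -/

section Generalization

open LimitTransformer

variable {Tok : Type u} [Fintype Tok] [Nonempty Tok] {α : Tok → ℝ} {p Δ τ : ℕ}
  {d k m d' k' m' o : ℕ} {f : LimitTransformer Tok d k m o} {g : LimitTransformer Tok d' k' m' o}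

theorem length_generalization (hα : ∀ s, 0 < α s) (hp : 0 < p) (hΔ : 0 < Δ)
    (hf : f.IsPeriodic Δ) (hft : f.IsTranslationInvariant) (hfτ : f.IsLocal τ)
    (hg : g.IsPeriodic Δ) (hgt : g.IsTranslationInvariant) (hgτ : g.IsLocal τ) {ε X : ℝ}
    (hε : 0 < ε) (hε₀ : ε ≤ 1 / (9 * ((τ : ℝ) + 2) ^ 2))
    (hL : √ε ≤ f.normBound Δ + g.normBound Δ)
    (hX : X = lengthBound p (min f.logitMargin g.logitMargin) (Fintype.card Tok) Δ
      (∑ s, α s) (⨅ s, α s) (f.normBound Δ + g.normBound Δ) ε) :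
    (trainingLength τ Δ X : ℝ) ≤ 200 * X ∧
      ((∀ N : ℕ, 1 ≤ N → N ≤ trainingLength τ Δ X → avgError f g α p N ≤ ε) →
        ∀ T : ℕ, 1 ≤ T → avgError f g α p T ≤ 77 * ε) := by
  set L := f.normBound Δ + g.normBound Δ with hLdef
  have hX1 : 1 ≤ X := hX ▸ one_le_lengthBound ..
  have hs : 0 < √ε := Real.sqrt_pos.2 hε
  have hsq : √ε * √ε = ε := Real.mul_self_sqrt hε.le
  have hτ0 : (0 : ℝ) ≤ τ := Nat.cast_nonneg τ
  have hΔ1 : (1 : ℝ) ≤ Δ := by exact_mod_cast hΔ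
  have hετ := sqrt_le_inv_of_le hε₀
  have hε36 : ε ≤ 1 / 36 := by nlinarith
  have hα₀ : 0 < ⨅ s, α s := by
    obtain ⟨s, hs⟩ := exists_eq_ciInf_of_finite (f := α)
    exact hs ▸ hα s
  obtain ⟨q, hq0, hq1, hqε, hqX⟩ := exists_threshold (Fintype.card_pos (α := Tok)) hΔ
    (Finset.sum_nonneg fun s _ => (hα s).le) hα₀ hε hε36 hL p
    (min f.logitMargin g.logitMargin)
  rw [← hX] at hqX
  have hΔ0 : (0 : ℝ) < Δ := by linarith
  set a := ⌈X / Δ⌉₊ with ha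
  have ha0 : 0 < a := Nat.ceil_pos.2 (by positivity)
  have haX : X ≤ a * Δ := (div_le_iff₀ hΔ0).1 (Nat.le_ceil _)
  have hLs : 1 ≤ L / ε * √ε := by
    rw [div_mul_eq_mul_div, le_div_iff₀ hε]
    nlinarith
  have hLτ : 3 * ((τ : ℝ) + 2) ≤ L / ε := by
    have hLε : 0 < L / ε := div_pos (hs.trans_le hL) hε
    nlinarith [mul_le_mul_of_nonneg_left hετ hLε.le,
      mul_le_mul_of_nonneg_right hLs (by positivity : (0 : ℝ) ≤ τ + 2)]
  refine ⟨?_, fun h T hT => ?_⟩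
  · have h1 : (L / ε) ^ 2 * (Δ : ℝ) ^ 5 ≤ 8 * X :=
      hqX.trans (by nlinarith [mul_le_mul_of_nonneg_right hq1 (by linarith : 0 ≤ X)])
    have h2 : (Δ : ℝ) ≤ Δ ^ 5 := le_self_pow₀ hΔ1 (by norm_num)
    have h3 : (τ : ℝ) + 1 ≤ (L / ε) ^ 2 := by nlinarith
    have h4 : (Δ : ℝ) ≤ 8 * X := by nlinarith
    have h5 : (τ : ℝ) ≤ 8 * X := by nlinarith
    linarith [trainingLength_le (τ := τ) hΔ (by linarith : 0 ≤ X)]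
  · rcases le_or_gt T (trainingLength τ Δ X) with hTN | hTN
    · linarith [h T hT hTN]
    · have hTN' : a * Δ + τ + Δ < T := hTN
      -- The suffix absorbs the residue of T, so τ ≤ l < τ + Δ and the length aΔ + l + 1 with the
      -- same suffix is among the training lengths.
      set l := τ + (T - τ - 1) % Δ with hl
      have hmod := Nat.mod_lt (T - τ - 1) hΔ
      have hdiv := Nat.div_add_mod (T - τ - 1) Δ
      set b := (T - τ - 1) / Δ with hb
      have hTeq : T = b * Δ + (l + 1) := by
        rw [mul_comm b]
        omega
      have hab : a ≤ b := by
        rw [hb, Nat.le_div_iff_mul_le hΔ]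
        omega
      have hn : (2 : ℝ) ^ ((p : ENNReal) / min f.logitMargin g.logitMargin).toReal ≤
          ((a * Δ + (l + 1) : ℕ) : ℝ) := by
        have h1 : (2 : ℝ) ^ ((p : ENNReal) / min f.logitMargin g.logitMargin).toReal ≤ X :=
          hX ▸ le_max_left _ _
        push_cast
        have : (0 : ℝ) ≤ l := Nat.cast_nonneg l
        linarith
      have hmain := avgError_le_add hα hf hft hfτ hg hgt hgτ hΔ hp (l := l) (by omega) ha0 hab hn
        hq0 hq1
      have htrain := h (a * Δ + (l + 1)) (by omega) (by
        change _ ≤ a * Δ + τ + Δ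
        omega)
      have hM : (L / ε) ^ 2 * (Δ : ℝ) ^ 4 ≤ 8 * (a * q) := by
        have h6 : q * X ≤ q * (a * Δ) := mul_le_mul_of_nonneg_left haX hq0.le
        refine le_of_mul_le_mul_right ?_ hΔ0
        calc (L / ε) ^ 2 * (Δ : ℝ) ^ 4 * Δ = (L / ε) ^ 2 * (Δ : ℝ) ^ 5 := by ring
          _ ≤ 8 * (q * X) := hqX
          _ ≤ 8 * (q * (a * Δ)) := by linarith
          _ = 8 * (a * q) * Δ := by ring
      have herr := error_term_le hΔ (by omega : l + 1 ≤ τ + Δ) hε hετ hL hM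
      rw [hTeq]
      -- The constant is 77 = 1 + 4 + 72: training error, exceptional event, concentration.
      rw [← hLdef, mul_assoc 4 L, hqε] at hmain
      linarith

end Generalization

theorem theorem2 :
    ∃ C : ℝ, 0 < C ∧ ∀ τ : ℕ, ∃ ε₀ : ℝ, 0 < ε₀ ∧
      ∀ (Tok : Type u) [Fintype Tok] [Nonempty Tok] (α : Tok → ℝ), (∀ s, 0 < α s) →
      ∀ p Δ : ℕ, 0 < p → 0 < Δ →
      ∀ (d k m d' k' m' o : ℕ)
        (f : LimitTransformer Tok d k m o) (g : LimitTransformer Tok d' k' m' o),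
        f.IsPeriodic Δ → f.IsTranslationInvariant → f.IsLocal τ →
        g.IsPeriodic Δ → g.IsTranslationInvariant → g.IsLocal τ →
        ∃ N₀ : ℝ → ℕ,
          (∀ ε : ℝ, 0 < ε → ε ≤ ε₀ →
            (N₀ ε : ℝ) ≤ C * lengthBound p (min f.logitMargin g.logitMargin) (Fintype.card Tok) Δ
              (∑ s, α s) (⨅ s, α s) (f.normBound Δ + g.normBound Δ) ε ∧
            ((∀ N : ℕ, 1 ≤ N → N ≤ N₀ ε → avgError f g α p N ≤ ε) →
              ∀ T : ℕ, 1 ≤ T → avgError f g α p T ≤ C * ε ^ (1 / 2 : ℝ))) ∧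
          (fun ε : ℝ => (N₀ ε : ℝ)) =O[nhdsWithin 0 (Set.Ioi 0)]
            (fun ε : ℝ => ε ^ (-(2 + 2 / ⨅ s, α s)) * Real.log (1 / ε)) := by
  refine ⟨200, by norm_num, fun τ => ⟨1 / (9 * ((τ : ℝ) + 2) ^ 2), by positivity, ?_⟩⟩
  intro Tok _ _ α hα p Δ hp hΔ d k m d' k' m' o f g hf hft hfτ hg hgt hgτ
  set X : ℝ → ℝ := lengthBound p (min f.logitMargin g.logitMargin) (Fintype.card Tok) Δ
    (∑ s, α s) (⨅ s, α s) (f.normBound Δ + g.normBound Δ) with hX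
  have hL0 : 0 ≤ f.normBound Δ + g.normBound Δ :=
    add_nonneg (hf.normBound_nonneg hΔ) (hg.normBound_nonneg hΔ)
  have hα₀ : 0 < ⨅ s, α s := by
    obtain ⟨s, hs⟩ := exists_eq_ciInf_of_finite (f := α)
    exact hs ▸ hα s
  set N₀ : ℝ → ℕ := fun ε =>
    if √ε ≤ f.normBound Δ + g.normBound Δ then trainingLength τ Δ (X ε) else 1 with hN₀
  have hmain : ∀ ε : ℝ, 0 < ε → ε ≤ 1 / (9 * ((τ : ℝ) + 2) ^ 2) →
      (N₀ ε : ℝ) ≤ 200 * X ε ∧ ((∀ N : ℕ, 1 ≤ N → N ≤ N₀ ε → avgError f g α p N ≤ ε) →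
        ∀ T : ℕ, 1 ≤ T → avgError f g α p T ≤ 200 * ε ^ (1 / 2 : ℝ)) := by
    intro ε hε hε₀
    rw [← Real.sqrt_eq_rpow]
    have hs : 0 < √ε := Real.sqrt_pos.2 hε
    have hsq : √ε * √ε = ε := Real.mul_self_sqrt hε.le
    have hετ := sqrt_le_inv_of_le hε₀
    have hεs : ε ≤ √ε := by nlinarith [Nat.cast_nonneg (α := ℝ) τ]
    by_cases hL : √ε ≤ f.normBound Δ + g.normBound Δ
    · simp only [hN₀, if_pos hL]
      obtain ⟨h1, h2⟩ := length_generalization hα hp hΔ hf hft hfτ hg hgt hgτ hε hε₀ hL rfl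
      exact ⟨h1, fun h T hT => (h2 h T hT).trans (by linarith)⟩
    -- Here L < √ε, so comparison with length 1 gives at most ε + 4L ≤ 5√ε.
    · simp only [hN₀, if_neg hL]
      refine ⟨?_, fun h T hT => ?_⟩
      · have : 1 ≤ X ε := one_le_lengthBound ..
        push_cast
        linarith
      · have h1 := avgError_le_add_normBound hα hf hg hΔ p one_pos hT
        linarith [h 1 le_rfl le_rfl]
  refine ⟨N₀, hmain, ?_⟩
  refine Asymptotics.IsBigO.trans ?_ (isBigO_lengthBound (Fintype.card_pos (α := Tok)) hΔ
    (A := ∑ s, α s) hα₀ hL0 p (min f.logitMargin g.logitMargin))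
  refine Asymptotics.IsBigO.of_bound 200 ?_
  filter_upwards [Ioc_mem_nhdsGT (by positivity : (0 : ℝ) < 1 / (9 * ((τ : ℝ) + 2) ^ 2))]
    with ε hε
  rw [Real.norm_of_nonneg (Nat.cast_nonneg _),
    Real.norm_of_nonneg (zero_le_one.trans (one_le_lengthBound ..))]
  exact (hmain ε hε.1 hε.2).1
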